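/- A Steiner quadruple system SQS$(n)$ is a pair $(X,\mathcal B)$ with $|X|=n$ and $\mathcal B$ a set of $4$-element subsets (blocks) of $X$ such that every $3$-element subset of $X$ lies in exactly one block. A $1$-ocycle for it is a nonempty cyclic listing of all the blocks, each listed exactly once and written as a string of its four points in some order, such that the last letter of each string is the first letter of the next one (cyclically). These shared letters are its overlap points. Theorem. Let $(X,\mathcal B)$ be an SQS$(n)$ that admits a $1$-ocycle. Then there exists an SQS$(4n-6)$ that admits a $1$-ocycle. More precisely, $n=2k+2$ for some integer $k$, and Hanani's fifth construction gives such a system, as follows. Identify $X$ with $\{0,\dots,n-3\}\cup\{A0,A1\}$ in any way, and regard $0,\dots,n-3$ as residues modulo $2k=n-2$. There exist * a system $P_\alpha$ ($0\le\alpha\le 2k-2$) of sets of unordered pairs of distinct elements of $\{0,\dots,2k-1\}$ such that every $P_\alpha$ partitions $\{0,\dots,2k-1\}$ and every pair of distinct elements lies in exactly one $P_\alpha$; and * a system $\overline P_\xi$ ($0\le\xi\le 2k-1$) of sets of unordered pairs of distinct elements of $\{0,\dots,2k-1\}$ such that, for $0\le\xi<k$, $\overline P_\xi$ partitions $\{0,\dots,2k-1\}\setminus\{2\xi,2\xi+1\}$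 and $\overline P_{k+\xi}$ partitions $\{0,\dots,2k-1\}$, and every pair of distinct elements lies in exactly one $\overline P_\xi$. For all such systems, the following blocks on $\mathcal Y=(\{0,1\}^2\times\{0,\dots,n-3\})\cup\{A0,A1\}$ form an SQS$(4n-6)$ that admits a $1$-ocycle in which every point $hiy$ ($h,i\in\{0,1\}$, $0\le y\le n-3$) is an overlap point. Here $hix$ denotes $(h,i,x)$; $h,i,\epsilon,\ell$ range over $\{0,1\}$, first and second coordinates are taken modulo $2$, third coordinates modulo $2k$; and in (2)–(9) $c_1,c_2,c_3$ range over the integers with $c_1+c_2+c_3\equiv 0 \pmod k$, where in (6)–(9) moreover $0\le c_3<k$. 1. the images of the blocks of $\mathcal B$ under $x\mapsto hix$, $A\ell\mapsto A\ell$; 2. $\{A\ell,\ 00(2c_1),\ 01(2c_2-\epsilon),\ 1\epsilon(2c_3+\ell)\}$; 3. $\{A\ell,\ 00(2c_1+1),\ 01(2c_2-1-\epsilon),\ 1\epsilon(2c_3+1-\ell)\}$; 4. $\{A\ell,\ 10(2c_1),\ 11(2c_2-\epsilon),\ 0\epsilon(2c_3+1-\ell)\}$; 5. $\{A\ell,\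 10(2c_1+1),\ 11(2c_2-1-\epsilon),\ 0\epsilon(2c_3+\ell)\}$; 6. $\{h0(2c_1+\epsilon),\ h1(2c_2-\epsilon),\ (h+1)0r,\ (h+1)0s\}$ with $\{r,s\}\in\overline P_{c_3}$; 7. $\{h0(2c_1-1+\epsilon),\ h1(2c_2-\epsilon),\ (h+1)1r,\ (h+1)1s\}$ with $\{r,s\}\in\overline P_{c_3}$; 8. $\{h0(2c_1+\epsilon),\ h1(2c_2-\epsilon),\ (h+1)1r,\ (h+1)1s\}$ with $\{r,s\}\in\overline P_{k+c_3}$; 9. $\{h0(2c_1-1+\epsilon),\ h1(2c_2-\epsilon),\ (h+1)0r,\ (h+1)0s\}$ with $\{r,s\}\in\overline P_{k+c_3}$; 10. $\{h0r,\ h0s,\ h1r',\ h1s'\}$ with $\{r,s\},\{r',s'\}\in P_\alpha$ for some $0\le\alpha\le 2k-2$ (possibly $\{r,s\}=\{r',s'\}$). -/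

import Mathlib

/-- `B` is the set of quadruples of a Steiner quadruple system of order `n` on the point set `X`. -/
structure IsSQS {X : Type*} (n : ℕ) (B : Set (Finset X)) : Prop where
  finite : Finite X
  card_points : Nat.card X = n
  card_block : ∀ b ∈ B, b.card = 4
  triple : ∀ T : Finset X, T.card = 3 → ∃! b, b ∈ B ∧ T ⊆ b

/-- `C` is an `s`-overlap cycle for the set of blocks `B`: a nonempty cyclic listing of all the
blocks, each listed exactly once, and as a string without repeated letters, such that the last `s`
letters of each string are the first `s` letters of the next one (cyclically). -/
structure IsOcycle {X : Type*} [DecidableEq X] (s : ℕ) (B : Set (Finset X))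
    (C : Cycle (List X)) : Prop where
  ne_nil : C ≠ Cycle.nil
  letters_nodup : ∀ w ∈ C, w.Nodup
  blocks_nodup : (C.map List.toFinset).Nodup
  mem_blocks : ∀ b : Finset X, b ∈ B ↔ ∃ w ∈ C, w.toFinset = b
  overlap : C.Chain (fun u v => u.rtake s = v.take s)

/-- `x` is an overlap point of the 1-overlap cycle `C`: it is the first letter of one of the strings
(and hence the last letter of the preceding one). -/
def IsOverlapPoint {X : Type*} (C : Cycle (List X)) (x : X) : Prop :=
  ∃ w ∈ C, w.head? = some x

namespace Hanani

/-- A system `P_α`, `0 ≤ α ≤ 2k - 2`, of unordered pairs on `2k` points: each `P_α` partitions the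
points into pairs, and each pair of distinct points lies in exactly one `P_α`. -/
structure IsPairSystem (k : ℕ) (P : ℕ → Set (Sym2 (ZMod (2 * k)))) : Prop where
  not_isDiag : ∀ α, α + 1 < 2 * k → ∀ p ∈ P α, ¬ p.IsDiag
  cover : ∀ α, α + 1 < 2 * k → ∀ x, ∃! p, p ∈ P α ∧ x ∈ p
  pair : ∀ p : Sym2 (ZMod (2 * k)), ¬ p.IsDiag → ∃! α, α + 1 < 2 * k ∧ p ∈ P α

/-- A system `Q_ξ`, `0 ≤ ξ < 2k`, of unordered pairs on `2k` points: for `ξ < k`, the set `Q_ξ`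
partitions the points other than `2ξ` and `2ξ + 1` into pairs, `Q_{k + ξ}` partitions all the points
into pairs, and each pair of distinct points lies in exactly one `Q_ξ`. -/
structure IsBarPairSystem (k : ℕ) (Q : ℕ → Set (Sym2 (ZMod (2 * k)))) : Prop where
  not_isDiag : ∀ ξ < 2 * k, ∀ p ∈ Q ξ, ¬ p.IsDiag
  omit_left : ∀ ξ < k, ∀ p ∈ Q ξ, (2 * ξ : ZMod (2 * k)) ∉ p
  omit_right : ∀ ξ < k, ∀ p ∈ Q ξ, (2 * ξ + 1 : ZMod (2 * k)) ∉ p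
  cover_low : ∀ ξ < k, ∀ x : ZMod (2 * k), x ≠ 2 * ξ → x ≠ 2 * ξ + 1 → ∃! p, p ∈ Q ξ ∧ x ∈ p
  cover_high : ∀ ξ < k, ∀ x, ∃! p, p ∈ Q (k + ξ) ∧ x ∈ p
  pair : ∀ p : Sym2 (ZMod (2 * k)), ¬ p.IsDiag → ∃! ξ, ξ < 2 * k ∧ p ∈ Q ξ

/-- The labels `{0, …, 2k - 1} ∪ {A0, A1}` of the points of the given system. -/
abbrev Label (k : ℕ) : Type := ZMod (2 * k) ⊕ ZMod 2

/-- The point set `({0, 1} × {0, 1} × {0, …, 2k - 1}) ∪ {A0, A1}` of the new system. -/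
abbrev Point (k : ℕ) : Type := (ZMod 2 × ZMod 2 × ZMod (2 * k)) ⊕ ZMod 2

/-- The point `hix`. -/
def pt {k : ℕ} (h i : ZMod 2) (x : ZMod (2 * k)) : Point k := Sum.inl (h, i, x)

/-- The point `Aℓ`. -/
def inf {k : ℕ} (l : ZMod 2) : Point k := Sum.inr l

/-- The map `h ⊕ i ⊕ ·`: put the prefix `hi` before `x`, and leave `A0` and `A1` alone. -/
def lift {k : ℕ} (h i : ZMod 2) : Label k → Point k
  | Sum.inl x => pt h i x
  | Sum.inr l => inf l

/-- The parameters `c₁, c₂, c₃` with `c₁ + c₂ + c₃ ≡ 0 (mod k)` and `ε ∈ {0, 1}`. -/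
def Params (k : ℕ) (c₁ c₂ c₃ ε : ℤ) : Prop :=
  c₁ + c₂ + c₃ ≡ 0 [ZMOD k] ∧ (ε = 0 ∨ ε = 1)

/-- The ten types of blocks of Hanani's fifth construction, applied to a system of order `2k + 2`
with block set `B` on a point set `X` labelled by `e`. -/
inductive Block {k : ℕ} {X : Type*} (e : X ≃ Label k) (B : Set (Finset X))
    (P Q : ℕ → Set (Sym2 (ZMod (2 * k)))) : Finset (Point k) → Prop
  | type1 (h i : ZMod 2) (b : Finset X) (hb : b ∈ B) :
      Block e B P Q (b.image fun x => lift h i (e x))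
  | type2 (c₁ c₂ c₃ ε l : ℤ) (hc : Params k c₁ c₂ c₃ ε) (hl : l = 0 ∨ l = 1) :
      Block e B P Q {inf l, pt 0 0 (2 * c₁), pt 0 1 (2 * c₂ - ε), pt 1 ε (2 * c₃ + l)}
  | type3 (c₁ c₂ c₃ ε l : ℤ) (hc : Params k c₁ c₂ c₃ ε) (hl : l = 0 ∨ l = 1) :
      Block e B P Q {inf l, pt 0 0 (2 * c₁ + 1), pt 0 1 (2 * c₂ - 1 - ε), pt 1 ε (2 * c₃ + 1 - l)}
  | type4 (c₁ c₂ c₃ ε l : ℤ) (hc : Params k c₁ c₂ c₃ ε) (hl : l = 0 ∨ l = 1) :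
      Block e B P Q {inf l, pt 1 0 (2 * c₁), pt 1 1 (2 * c₂ - ε), pt 0 ε (2 * c₃ + 1 - l)}
  | type5 (c₁ c₂ c₃ ε l : ℤ) (hc : Params k c₁ c₂ c₃ ε) (hl : l = 0 ∨ l = 1) :
      Block e B P Q {inf l, pt 1 0 (2 * c₁ + 1), pt 1 1 (2 * c₂ - 1 - ε), pt 0 ε (2 * c₃ + l)}
  | type6 (h : ZMod 2) (c₁ c₂ : ℤ) (c₃ : ℕ) (ε : ℤ) (hc : Params k c₁ c₂ c₃ ε) (h₃ : c₃ < k)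
      (r s : ZMod (2 * k)) (hrs : s(r, s) ∈ Q c₃) :
      Block e B P Q {pt h 0 (2 * c₁ + ε), pt h 1 (2 * c₂ - ε), pt (h + 1) 0 r, pt (h + 1) 0 s}
  | type7 (h : ZMod 2) (c₁ c₂ : ℤ) (c₃ : ℕ) (ε : ℤ) (hc : Params k c₁ c₂ c₃ ε) (h₃ : c₃ < k)
      (r s : ZMod (2 * k)) (hrs : s(r, s) ∈ Q c₃) :
      Block e B P Q {pt h 0 (2 * c₁ - 1 + ε), pt h 1 (2 * c₂ - ε), pt (h + 1) 1 r, pt (h + 1) 1 s}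
  | type8 (h : ZMod 2) (c₁ c₂ : ℤ) (c₃ : ℕ) (ε : ℤ) (hc : Params k c₁ c₂ c₃ ε) (h₃ : c₃ < k)
      (r s : ZMod (2 * k)) (hrs : s(r, s) ∈ Q (k + c₃)) :
      Block e B P Q {pt h 0 (2 * c₁ + ε), pt h 1 (2 * c₂ - ε), pt (h + 1) 1 r, pt (h + 1) 1 s}
  | type9 (h : ZMod 2) (c₁ c₂ : ℤ) (c₃ : ℕ) (ε : ℤ) (hc : Params k c₁ c₂ c₃ ε) (h₃ : c₃ < k)
      (r s : ZMod (2 * k)) (hrs : s(r, s) ∈ Q (k + c₃)) :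
      Block e B P Q {pt h 0 (2 * c₁ - 1 + ε), pt h 1 (2 * c₂ - ε), pt (h + 1) 0 r, pt (h + 1) 0 s}
  | type10 (h : ZMod 2) (α : ℕ) (hα : α + 1 < 2 * k) (r s r' s' : ZMod (2 * k))
      (hrs : s(r, s) ∈ P α) (hrs' : s(r', s') ∈ P α) :
      Block e B P Q {pt h 0 r, pt h 0 s, pt h 1 r', pt h 1 s'}

/-- The block set of Hanani's fifth construction. -/
def blocks {k : ℕ} {X : Type*} (e : X ≃ Label k) (B : Set (Finset X))
    (P Q : ℕ → Set (Sym2 (ZMod (2 * k)))) : Set (Finset (Point k)) :=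
  {b | Block e B P Q b}

end Hanani

/-!
# Overlap cycles in Hanani's fifth construction of Steiner quadruple systems

Two independent facts give the theorem.

*Every Steiner quadruple system of order `N ≥ 14` has a 1-overlap cycle through all of its points*
(`IsSQS.exists_ocycle`). If every block is given two of its points as ends, the blocks become the
edges of a multigraph on the points, and an Euler circuit of it is a 1-overlap cycle: traverse the
blocks along the circuit, and write the two remaining points of each block between its ends. So it
suffices to choose the ends such that all degrees are even and some point `x` is adjacent to all the
others. By Hall's theorem every `y ≠ x` can be given two blocks through `x` and `y`, all these
blocks being distinct, since a pair of points lies in `(N - 2) / 2 ≥ 6` blocks. The first block of `y`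
gets the ends `x, y`, which settles the adjacency. The second one gets the ends `z, x` or `z, y`, where
`z` is a further point of the block; passing from one to the other changes the parity of the degrees
of `x` and `y` only, so that the degree of every `y ≠ x` can be made even, and then the degree of
`x` is even because the sum of all degrees is.

*The blocks of the construction form a Steiner quadruple system of order `8k + 2`*
(`Hanani.isSQS_blocks`). For given `x` and `y` there are exactly one `c` with `0 ≤ c < k` and one
`ε ∈ {0, 1}` with `x + y + 2c + ε = 0` modulo `2k`. In these terms the blocks of types 2 to 9 that
contain `h0x` and `h1y` are obtained by adjoining `Aℓ` and `(h+1)εz` with `z ∈ {2c, 2c + 1}`, where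
`ℓ` is determined by the parities of `x`, `z` and `h`, or a pair in `Q c` with the prefix
`(h+1)ε`, or a pair in `Q (k + c)` with the prefix `(h+1)(ε+1)`. With this it is
readily checked that every triple lies in a block (`Hanani.covered_of_ne`), and that the number of
blocks is at most a quarter of the number of triples (`Hanani.ncard_normalForm_le`). Hence no triple
lies in two blocks.

The given overlap cycle excludes the orders `n ≤ 4`, as it has more than one string; and `n` is even
because the blocks through two points partition the other ones into pairs. So `n = 2k + 2` with
`k ≥ 2`, and `4n - 6 ≥ 14`. As to the two systems of pairs, both arise from classifying pairs by
the sum of their elements, in `ZMod (2k - 1)` with a point at infinity and in `ZMod (2k)`.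
-/

/-! ### Counting blocks -/

section Counting

open Finset

variable {X : Type*} [Fintype X] [DecidableEq X]

/-- Double counting of the pairs `(T, b)` with `T` a triple contained in the block `b`. -/
theorem sum_card_blocks_above_triples (𝓑 : Finset (Finset X)) (h4 : ∀ b ∈ 𝓑, b.card = 4) :
    ∑ T ∈ powersetCard 3 (univ : Finset X), (𝓑.filter fun b => T ⊆ b).card = 4 * 𝓑.card := by
  have h := sum_card_bipartiteAbove_eq_sum_card_bipartiteBelow
    (s := powersetCard 3 (univ : Finset X)) (t := 𝓑) (fun T b => T ⊆ b)
  simp only [bipartiteAbove, bipartiteBelow] at h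
  rw [h, mul_comm, ← smul_eq_mul, ← sum_const]
  refine sum_congr rfl fun b hb => ?_
  have : (powersetCard 3 (univ : Finset X)).filter (fun T => T ⊆ b) = powersetCard 3 b := by
    ext T
    simp [mem_powersetCard, and_comm]
  rw [this, card_powersetCard, h4 b hb]
  rfl

theorem IsSQS.four_mul_ncard {n : ℕ} {B : Set (Finset X)} (hB : IsSQS n B) :
    4 * B.ncard = n.choose 3 := by
  classical
  have hcard := hB.card_points
  rw [Nat.card_eq_fintype_card] at hcard
  rw [Set.ncard_eq_toFinset_card', ← sum_card_blocks_above_triples B.toFinset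
    (fun b hb => hB.card_block b (by simpa using hb)), ← hcard, ← card_univ, ← card_powersetCard,
    card_eq_sum_ones]
  refine sum_congr rfl fun T hT => ?_
  rw [card_eq_one]
  obtain ⟨b, hb, hu⟩ := hB.triple T (mem_powersetCard.1 hT).2
  refine ⟨b, ?_⟩
  ext c
  simp only [mem_filter, Set.mem_toFinset, mem_singleton]
  exact ⟨fun h => hu c h, fun h => h ▸ hb⟩

/-- A family of quadruples that covers every triple and has no more members than a Steiner quadruple
system is one: there is no room for a triple to be covered twice. -/
theorem IsSQS.of_cover {B : Set (Finset X)} (h4 : ∀ b ∈ B, b.card = 4)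
    (hcov : ∀ T : Finset X, T.card = 3 → ∃ b ∈ B, T ⊆ b)
    (hle : 4 * B.ncard ≤ (Fintype.card X).choose 3) : IsSQS (Fintype.card X) B := by
  classical
  refine ⟨inferInstance, Nat.card_eq_fintype_card, h4, fun T hT => ?_⟩
  rw [Set.ncard_eq_toFinset_card', ← sum_card_blocks_above_triples B.toFinset
    (fun b hb => h4 b (by simpa using hb)), ← card_univ, ← card_powersetCard,
    card_eq_sum_ones] at hle
  have hpos : ∀ T ∈ powersetCard 3 (univ : Finset X),
      1 ≤ (B.toFinset.filter fun b => T ⊆ b).card := by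
    intro T hT
    obtain ⟨b, hb, hTb⟩ := hcov T (mem_powersetCard.1 hT).2
    exact card_pos.2 ⟨b, by simp [hb, hTb]⟩
  have heq := (sum_eq_sum_iff_of_le hpos).1 (le_antisymm (sum_le_sum hpos) hle) T (by simp [hT])
  obtain ⟨b, hb⟩ := card_eq_one.1 heq.symm
  have hmem : ∀ c, c ∈ B ∧ T ⊆ c ↔ c = b := fun c => by
    simpa using Finset.ext_iff.1 hb c
  exact ⟨b, (hmem b).2 rfl, fun c hc => (hmem c).1 hc⟩

/-- Every pair of points lies in `(n - 2) / 2` blocks. -/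
theorem IsSQS.two_mul_card_pair {n : ℕ} {𝓑 : Finset (Finset X)} (hB : IsSQS n (𝓑 : Set (Finset X)))
    {x y : X} (hxy : x ≠ y) : 2 * (𝓑.filter fun b => x ∈ b ∧ y ∈ b).card + 2 = n := by
  have hcard := hB.card_points
  rw [Nat.card_eq_fintype_card] at hcard
  have hpair : ({x, y} : Finset X).card = 2 := card_pair hxy
  have h := sum_card_bipartiteAbove_eq_sum_card_bipartiteBelow
    (s := univ \ {x, y}) (t := 𝓑.filter fun b => x ∈ b ∧ y ∈ b) (fun z b => z ∈ b)
  simp only [bipartiteAbove, bipartiteBelow] at h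
  rw [sum_congr rfl (g := fun _ => 1), sum_congr (s₂ := 𝓑.filter fun b => x ∈ b ∧ y ∈ b) rfl
    (g := fun _ => 2)] at h
  · rw [sum_const, sum_const, card_sdiff_of_subset (subset_univ _), card_univ, hpair, hcard] at h
    have : ({x, y} : Finset X).card ≤ Fintype.card X := card_le_univ _
    simp only [smul_eq_mul] at h
    omega
  · intro b hb
    rw [mem_filter] at hb
    have : (univ \ {x, y}).filter (fun z => z ∈ b) = b \ {x, y} := by
      ext z
      simp [and_comm]
    rw [this, card_sdiff_of_subset (by simp [insert_subset_iff, hb.2]),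
      hB.card_block b (by simpa using hb.1), hpair]
  · intro z hz
    simp only [mem_sdiff, mem_univ, mem_insert, mem_singleton, true_and, not_or] at hz
    obtain ⟨b, hb, hu⟩ := hB.triple {x, y, z} (card_eq_three.2
      ⟨x, y, z, hxy, Ne.symm hz.1, Ne.symm hz.2, rfl⟩)
    rw [card_eq_one]
    refine ⟨b, ?_⟩
    ext c
    simp only [mem_filter, mem_singleton]
    constructor
    · rintro ⟨⟨h1, h2, h3⟩, h4⟩
      exact hu c ⟨by simpa using h1, by simp [insert_subset_iff, h2, h3, h4]⟩
    · rintro rfl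
      simpa [insert_subset_iff, and_assoc] using hb

end Counting

/-! ### Euler circuits -/

section Euler

open Finset

variable {V E : Type*}

/-- The tail of an oriented edge: `(e, true)` is `e` traversed from `s e` to `t e`, and `(e, false)`
is `e` traversed backwards. -/
def dartSrc (s t : E → V) (d : E × Bool) : V := if d.2 then s d.1 else t d.1

/-- The head of an oriented edge. -/
def dartTgt (s t : E → V) (d : E × Bool) : V := if d.2 then t d.1 else s d.1

/-- The number of times that an edge ends at `v`. -/
def endCount [DecidableEq V] (s t : E → V) (v : V) (e : E) : ℕ :=
  (if s e = v then 1 else 0) + (if t e = v then 1 else 0)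

/-- A trail: a list of oriented edges, each starting where the preceding one ends, that uses no edge
twice. -/
structure IsTrail (s t : E → V) (L : List (E × Bool)) : Prop where
  chain : L.IsChain fun a b => dartTgt s t a = dartSrc s t b
  nodup : (L.map Prod.fst).Nodup

/-- Along a trail every vertex has even degree, except that each of the two ends of the trail
contributes one more. -/
theorem even_sum_endCount [DecidableEq V] {s t : E → V} (v : V) :
    ∀ (L : List (E × Bool)) (a : E × Bool),
      (a :: L).IsChain (fun a b => dartTgt s t a = dartSrc s t b) →
      Even (((a :: L).map fun d => endCount s t v d.1).sum + (if dartSrc s t a = v then 1 else 0) +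
        (if dartTgt s t ((a :: L).getLast (List.cons_ne_nil _ _)) = v then 1 else 0))
  | [], (e, o), _ => by
    cases o <;> simp [endCount, dartSrc, dartTgt] <;> split_ifs <;> decide
  | b :: L, (e, o), h => by
    rw [List.isChain_cons_cons] at h
    have ih := even_sum_endCount v L b h.2
    rw [List.getLast_cons (List.cons_ne_nil _ _), List.map_cons, List.sum_cons]
    rw [← h.1] at ih
    generalize dartTgt s t ((b :: L).getLast _) = q at ih ⊢
    generalize ((b :: L).map fun d => endCount s t v d.1).sum = S at ih ⊢
    have key : endCount s t v e + (if dartSrc s t (e, o) = v then 1 else 0) =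
        2 * (if dartSrc s t (e, o) = v then 1 else 0) +
          (if dartTgt s t (e, o) = v then 1 else 0) := by
      cases o <;> simp [endCount, dartSrc, dartTgt] <;> split_ifs <;> rfl
    rw [Nat.even_iff] at ih ⊢
    simp only at key ⊢
    omega

/-- A finite multigraph with even degrees, one vertex `x` of which is adjacent to all the others,
has an Euler circuit. -/
theorem exists_euler_circuit [Fintype E] [Nonempty E] [DecidableEq V] (s t : E → V) (x : V)
    (heven : ∀ v, Even (∑ e, endCount s t v e))
    (hstar : ∀ y, y ≠ x → ∃ e, s e = x ∧ t e = y) :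
    ∃ L : List (E × Bool), (∀ e, e ∈ L.map Prod.fst) ∧ (L.map Prod.fst).Nodup ∧
      Cycle.Chain (fun a b => dartTgt s t a = dartSrc s t b) (L : Cycle (E × Bool)) := by
  classical
  -- a longest trail
  obtain ⟨L, hL, hmax⟩ : ∃ L, IsTrail s t L ∧ ∀ M, IsTrail s t M → M.length ≤ L.length := by
    have hbdd : ∀ M, IsTrail s t M → M.length ≤ Fintype.card E := fun M hM => by
      simpa using hM.nodup.length_le_card
    let S : Set ℕ := {m | ∃ L, IsTrail s t L ∧ L.length = m}
    have hS : S.Nonempty := ⟨0, [], ⟨List.isChain_nil, List.nodup_nil⟩, rfl⟩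
    have hSb : BddAbove S := ⟨Fintype.card E, by rintro m ⟨L, hL, rfl⟩; exact hbdd L hL⟩
    obtain ⟨L, hL, hm⟩ := Nat.sSup_mem hS hSb
    exact ⟨L, hL, fun M hM => hm ▸ le_csSup hSb ⟨M, hM, rfl⟩⟩
  -- no unused edge leaves the end of a trail as long as the longest one
  have hext : ∀ M (hM : M ≠ []), IsTrail s t M → M.length = L.length → ∀ e,
      s e = dartTgt s t (M.getLast hM) ∨ t e = dartTgt s t (M.getLast hM) →
        e ∈ M.map Prod.fst := by
    intro M hM hMt hlen e he
    by_contra hn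
    obtain ⟨o, ho⟩ : ∃ o, dartSrc s t (e, o) = dartTgt s t (M.getLast hM) := by
      rcases he with he | he
      · exact ⟨true, by simpa [dartSrc] using he⟩
      · exact ⟨false, by simpa [dartSrc] using he⟩
    have := hmax (M ++ [(e, o)]) ⟨?_, ?_⟩
    · simp at this
      omega
    · rw [List.isChain_append]
      refine ⟨hMt.chain, List.isChain_singleton _, ?_⟩
      intro a ha b hb
      rw [List.getLast?_eq_getLast_of_ne_nil hM] at ha
      simp at ha hb
      subst ha hb
      exact ho.symm
    · rw [List.map_append, List.nodup_append]
      refine ⟨hMt.nodup, by simp, ?_⟩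
      intro a ha b hb
      simp at hb
      rintro rfl
      exact hn (hb ▸ ha)
  have hne : L ≠ [] := by
    rintro rfl
    have e := Classical.arbitrary E
    have := hmax [(e, true)] ⟨List.isChain_singleton _, by simp⟩
    simp at this
  obtain ⟨a, M, rfl⟩ := List.exists_cons_of_ne_nil hne
  -- the longest trail is closed, since the unused edges at its end are even in number otherwise
  have hclosed : dartTgt s t ((a :: M).getLast hne) = dartSrc s t a := by
    by_contra hcl
    have h1 := even_sum_endCount (dartTgt s t ((a :: M).getLast hne)) M a hL.chain
    rw [if_neg (Ne.symm hcl), if_pos rfl] at h1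
    have h2 := heven (dartTgt s t ((a :: M).getLast hne))
    have h3 : ∑ e, endCount s t (dartTgt s t ((a :: M).getLast hne)) e =
        (((a :: M).map Prod.fst).map
          (endCount s t (dartTgt s t ((a :: M).getLast hne)))).sum := by
      rw [← List.sum_toFinset _ hL.nodup]
      symm
      refine sum_subset (subset_univ _) fun e _ he => ?_
      rw [List.mem_toFinset] at he
      have h4 := mt (hext _ hne hL rfl e) he
      rw [not_or] at h4
      simp [endCount, h4.1, h4.2]
    rw [h3, List.map_map] at h2
    rw [Nat.even_iff] at h1 h2
    simp only [Function.comp_def] at h2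
    omega
  have hcyc : Cycle.Chain (fun a b => dartTgt s t a = dartSrc s t b)
      ((a :: M : List (E × Bool)) : Cycle (E × Bool)) := by
    rw [Cycle.chain_coe_cons, ← List.cons_append, List.isChain_append]
    refine ⟨hL.chain, List.isChain_singleton _, ?_⟩
    intro p hp q hq
    rw [List.getLast?_eq_getLast_of_ne_nil hne] at hp
    simp at hp hq
    subst hp hq
    exact hclosed
  -- every edge that touches the circuit belongs to it, by rotating the circuit
  have htouch : ∀ d ∈ a :: M, ∀ e, s e = dartTgt s t d ∨ t e = dartTgt s t d →
      e ∈ (a :: M).map Prod.fst := by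
    intro d hd e he
    obtain ⟨l₁, l₂, hl⟩ := List.append_of_mem hd
    have hrot : ((a :: M : List (E × Bool)) : Cycle (E × Bool)) =
        ((d :: (l₂ ++ l₁) : List (E × Bool)) : Cycle (E × Bool)) := by
      rw [hl, Cycle.coe_eq_coe, ← List.cons_append]
      exact List.isRotated_append
    have hperm : (a :: M).Perm (l₂ ++ l₁ ++ [d]) := by
      rw [hl, List.append_assoc]
      refine List.perm_append_comm.trans ?_
      rw [List.cons_append]
      refine (List.perm_append_singleton d (l₂ ++ l₁)).symm.trans ?_
      rw [List.append_assoc]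
    rw [hrot, Cycle.chain_coe_cons, List.isChain_cons] at hcyc
    have := hext (l₂ ++ l₁ ++ [d]) (by simp) ⟨hcyc.2, (hperm.map _).nodup_iff.1 hL.nodup⟩
      hperm.length_eq.symm e (by simpa using he)
    exact ((hperm.map _).mem_iff).2 this
  -- every vertex of the circuit is the head of one of its oriented edges
  have htouch' : ∀ e ∈ (a :: M).map Prod.fst, ∀ v, s e = v ∨ t e = v →
      ∃ d ∈ a :: M, dartTgt s t d = v := by
    intro e he v hv
    obtain ⟨d, hd, rfl⟩ := List.mem_map.1 he
    by_cases htv : dartTgt s t d = v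
    · exact ⟨d, hd, htv⟩
    have hsv : dartSrc s t d = v := by
      unfold dartSrc dartTgt at *
      split_ifs at * <;> tauto
    obtain ⟨l₁, l₂, hl⟩ := List.append_of_mem hd
    have hrot : ((a :: M : List (E × Bool)) : Cycle (E × Bool)) =
        ((d :: (l₂ ++ l₁) : List (E × Bool)) : Cycle (E × Bool)) := by
      rw [hl, Cycle.coe_eq_coe, ← List.cons_append]
      exact List.isRotated_append
    rw [hrot, Cycle.chain_coe_cons, ← List.cons_append, List.isChain_append] at hcyc
    have h5 := hcyc.2.2 ((d :: (l₂ ++ l₁)).getLast (by simp))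
      (by rw [List.getLast?_eq_getLast_of_ne_nil (by simp)]; rfl) d (by simp)
    have h6 : (d :: (l₂ ++ l₁)).getLast (by simp) ∈ d :: (l₂ ++ l₁) := List.getLast_mem _
    refine ⟨_, ?_, h5.trans hsv⟩
    rw [hl]
    simp only [List.mem_cons, List.mem_append] at h6 ⊢
    tauto
  -- `x` lies on the circuit
  have hx : ∃ d ∈ a :: M, dartTgt s t d = x := by
    by_cases hax : dartTgt s t a = x
    · exact ⟨a, by simp, hax⟩
    obtain ⟨e, hes, het⟩ := hstar _ hax
    exact htouch' e (htouch a (by simp) e (Or.inr het)) x (Or.inl hes)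
  obtain ⟨d, hd, hdx⟩ := hx
  refine ⟨a :: M, fun e => ?_, hL.nodup, hcyc⟩
  by_cases hex : s e = x
  · exact htouch d hd e (Or.inl (hex.trans hdx.symm))
  · obtain ⟨f, hfs, hft⟩ := hstar _ hex
    obtain ⟨d', hd', hd's⟩ := htouch' f (htouch d hd f (Or.inl (hfs.trans hdx.symm))) _ (Or.inr hft)
    exact htouch d' hd' e (Or.inl hd's.symm)

end Euler

/-! ### Overlap cycles of Steiner quadruple systems -/

section Ocycle

open Finset

/-- A quadruple can be written as a string with given first and last letters. -/
theorem exists_string {V : Type*} [DecidableEq V] {b : Finset V} (hb : b.card = 4)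
    {p q : V} (hp : p ∈ b) (hq : q ∈ b) (hpq : p ≠ q) :
    ∃ w : List V, w.Nodup ∧ w.toFinset = b ∧ w.take 1 = [p] ∧ w.rtake 1 = [q] := by
  have hsub : ({p, q} : Finset V) ⊆ b := by simp [insert_subset_iff, hp, hq]
  obtain ⟨u, v, huv, h⟩ := card_eq_two.1
    (by rw [card_sdiff_of_subset hsub, hb, card_pair hpq] : (b \ {p, q}).card = 2)
  have hu : u ∈ b \ {p, q} := by simp [h]
  have hv : v ∈ b \ {p, q} := by simp [h]
  simp only [mem_sdiff, mem_insert, mem_singleton, not_or] at hu hv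
  refine ⟨[p, u, v, q], ?_, ?_, rfl, ?_⟩
  · simp [hpq, huv, Ne.symm hu.2.1, Ne.symm hv.2.1, hu.2.2, hv.2.2]
  · rw [← sdiff_union_of_subset hsub, h]
    ext z
    simp
  · simp [List.rtake_eq_reverse_take_reverse]

variable {V : Type*} [Fintype V] [DecidableEq V]

/-- For a given point `x`, every other point `y` can be given two blocks through `x` and `y`, all
these blocks being distinct. This is Hall's theorem: a pair of points lies in `(n - 2) / 2 ≥ 6`
blocks, and a block through `x` has `3` further points. -/
theorem IsSQS.exists_injective_blocks {n : ℕ} {𝓑 : Finset (Finset V)}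
    (hB : IsSQS n (𝓑 : Set (Finset V))) (hn : 14 ≤ n) (x : V) :
    ∃ φ : {y // y ≠ x} × Bool → Finset V, Function.Injective φ ∧
      ∀ i, φ i ∈ 𝓑 ∧ x ∈ φ i ∧ (i.1 : V) ∈ φ i := by
  obtain ⟨φ, hφ, hmem⟩ := (all_card_le_biUnion_card_iff_exists_injective
    (fun i : {y // y ≠ x} × Bool => 𝓑.filter fun b => x ∈ b ∧ (i.1 : V) ∈ b)).1 (by
      intro S
      have h1 : S.card ≤ (S.image Prod.fst).card * 2 := by
        have hsub : S ⊆ S.image Prod.fst ×ˢ (univ : Finset Bool) := fun i hi =>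
          mem_product.2 ⟨mem_image_of_mem _ hi, mem_univ _⟩
        simpa using card_le_card hsub
      have h2 : (S.image Prod.fst).card * 6 ≤
          (S.biUnion fun i => 𝓑.filter fun b => x ∈ b ∧ (i.1 : V) ∈ b).card * 3 := by
        refine card_mul_le_card_mul (fun (y : {y // y ≠ x}) (b : Finset V) => (y : V) ∈ b) ?_ ?_
        · intro y hy
          obtain ⟨i, hi, rfl⟩ := mem_image.1 hy
          have h3 := hB.two_mul_card_pair (Ne.symm i.1.2)
          refine le_trans (by omega : 6 ≤ (𝓑.filter fun b => x ∈ b ∧ (i.1 : V) ∈ b).card)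
            (card_le_card fun b hb => ?_)
          rw [bipartiteAbove, mem_filter, mem_biUnion]
          exact ⟨⟨i, hi, hb⟩, (mem_filter.1 hb).2.2⟩
        · intro b hb
          obtain ⟨i, hi, hb⟩ := mem_biUnion.1 hb
          rw [mem_filter] at hb
          have h4 : (b.erase x).card = 3 := by
            rw [card_erase_of_mem hb.2.1, hB.card_block b (by simpa using hb.1)]
          rw [← h4, ← card_map (Function.Embedding.subtype fun y => y ≠ x)]
          refine card_le_card fun z hz => ?_
          rw [mem_map] at hz
          obtain ⟨y, hy, rfl⟩ := hz
          exact mem_erase.2 ⟨y.2, (mem_filter.1 hy).2⟩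
      omega)
  exact ⟨φ, hφ, fun i => mem_filter.1 (hmem i)⟩

/-- The blocks can be given two distinct end points each such that the resulting multigraph has even
degrees and a vertex that is adjacent to all the others. -/
theorem IsSQS.exists_even_ends {n : ℕ} {𝓑 : Finset (Finset V)}
    (hB : IsSQS n (𝓑 : Set (Finset V))) (hn : 14 ≤ n) (x : V) :
    ∃ s t : 𝓑 → V, (∀ b, s b ∈ b.1 ∧ t b ∈ b.1 ∧ s b ≠ t b) ∧
      (∀ v, Even (∑ b, endCount s t v b)) ∧ ∀ y, y ≠ x → ∃ b, s b = x ∧ t b = y := by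
  obtain ⟨φ, hφ, hmem⟩ := hB.exists_injective_blocks hn x
  -- preliminary ends: `x, y` for the first block of `y`, and `z, x` with `z ≠ y` for the second one
  have hends : ∀ b : 𝓑, ∃ p : V × V, (p.1 ∈ b.1 ∧ p.2 ∈ b.1 ∧ p.1 ≠ p.2) ∧
      (∀ y, φ (y, false) = b.1 → p = (x, y.1)) ∧
      (∀ y, φ (y, true) = b.1 → p.1 ≠ y.1 ∧ p.2 = x) := by
    rintro ⟨b, hb⟩
    have hb4 : b.card = 4 := hB.card_block b (by simpa using hb)
    by_cases h : ∃ i, φ i = b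
    · obtain ⟨⟨y, o⟩, rfl⟩ := h
      obtain ⟨-, hx, hy⟩ := hmem (y, o)
      cases o
      · refine ⟨(x, y.1), ⟨hx, hy, Ne.symm y.2⟩, fun y' h => ?_, fun y' h => ?_⟩
        · obtain rfl : y' = y := congrArg Prod.fst (hφ h)
          rfl
        · exact absurd (Prod.ext_iff.1 (hφ h)).2 (by simp)
      · obtain ⟨z, hz, hzn⟩ := exists_mem_notMem_of_card_lt_card
          (s := {x, y.1}) (t := φ (y, true)) 
          (by rw [hb4]; exact lt_of_le_of_lt card_le_two (by simp))
        simp only [mem_insert, mem_singleton, not_or] at hzn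
        refine ⟨(z, x), ⟨hz, hx, hzn.1⟩, fun y' h => ?_, fun y' h => ?_⟩
        · exact absurd (Prod.ext_iff.1 (hφ h)).2 (by simp)
        · obtain rfl : y' = y := congrArg Prod.fst (hφ h)
          exact ⟨hzn.2, rfl⟩
    · obtain ⟨p, hp, q, hq, hpq⟩ := one_lt_card.1 (by rw [hb4]; simp : 1 < b.card)
      push Not at h
      exact ⟨(p, q), ⟨hp, hq, hpq⟩, fun y hy => absurd hy (h _), fun y hy => absurd hy (h _)⟩
  choose p hp hpf hpt using hends
  set s : 𝓑 → V := fun b => (p b).1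
  set t₀ : 𝓑 → V := fun b => (p b).2
  -- where `y` has odd degree, the second block of `y` gets the ends `z, y` instead of `z, x`
  let flip (b : 𝓑) (y : {y // y ≠ x}) : Prop :=
    φ (y, true) = b.1 ∧ ¬ Even (∑ b, endCount s t₀ y.1 b)
  let t : 𝓑 → V := fun b => if h : ∃ y, flip b y then (h.choose : V) else t₀ b
  have ht : ∀ b y, flip b y → t b = y := by
    intro b y hy
    have h : ∃ y, flip b y := ⟨y, hy⟩
    simp only [t, dif_pos h]
    exact congrArg Subtype.val (Prod.ext_iff.1 (hφ (h.choose_spec.1.trans hy.1.symm))).1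
  have ht₀ : ∀ b, (∀ y, ¬ flip b y) → t b = t₀ b := by
    intro b h
    exact dif_neg (not_exists.2 h)
  have hdeg : ∀ v, v ≠ x → Even (∑ b, endCount s t v b) := by
    intro v hv
    by_cases hodd : Even (∑ b, endCount s t₀ v b)
    · suffices h : ∑ b, endCount s t v b = ∑ b, endCount s t₀ v b by rwa [h]
      refine sum_congr rfl fun b _ => ?_
      by_cases h : ∃ y, flip b y
      · obtain ⟨y, hy⟩ := h
        have h1 : t b ≠ v := by
          rw [ht b y hy]
          rintro rfl
          exact hy.2 hodd
        have h2 : t₀ b ≠ v := by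
          rw [show t₀ b = x from (hpt b y hy.1).2]
          exact hv.symm
        simp [endCount, h1, h2]
      · simp only [endCount, ht₀ b (not_exists.1 h)]
    · have hm := (hmem (⟨v, hv⟩, true)).1
      set c : 𝓑 := ⟨φ (⟨v, hv⟩, true), hm⟩
      have hc : flip c ⟨v, hv⟩ := ⟨rfl, hodd⟩
      rw [← Nat.even_add_one] at hodd
      suffices h : ∑ b, endCount s t v b = ∑ b, endCount s t₀ v b + 1 by rwa [h]
      rw [← add_sum_erase _ _ (mem_univ c), ← add_sum_erase univ (endCount s t₀ v) (mem_univ c),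
        add_right_comm]
      congr 1
      · have h2 : t₀ c ≠ v := by
          rw [show t₀ c = x from (hpt c ⟨v, hv⟩ rfl).2]
          exact hv.symm
        simp [endCount, ht c _ hc, h2]
      · refine sum_congr rfl fun b hb => ?_
        by_cases h : ∃ y, flip b y
        · obtain ⟨y, hy⟩ := h
          have h1 : t b ≠ v := by
            rw [ht b y hy]
            rintro rfl
            exact (mem_erase.1 hb).1 (Subtype.ext hy.1.symm)
          have h2 : t₀ b ≠ v := by
            rw [show t₀ b = x from (hpt b y hy.1).2]
            exact hv.symm
          simp [endCount, h1, h2]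
        · simp only [endCount, ht₀ b (not_exists.1 h)]
  refine ⟨s, t, fun b => ?_, fun v => ?_, fun y hy => ?_⟩
  · by_cases h : ∃ y, flip b y
    · obtain ⟨y, hy⟩ := h
      rw [ht b y hy]
      exact ⟨(hp b).1, hy.1 ▸ (hmem (y, true)).2.2, (hpt b y hy.1).1⟩
    · rw [ht₀ b (not_exists.1 h)]
      exact hp b
  · by_cases hv : v = x
    · -- the degree of `x` is even because the sum of all degrees is
      subst hv
      have htot : ∑ w, ∑ b, endCount s t w b = 2 * 𝓑.card := by
        rw [sum_comm]
        simp [endCount, sum_add_distrib, mul_comm]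
      rw [← add_sum_erase _ _ (mem_univ v)] at htot
      have h1 : Even (∑ w ∈ univ.erase v, ∑ b, endCount s t w b) :=
        even_sum _ fun w hw => hdeg w (mem_erase.1 hw).1
      rw [Nat.even_iff] at h1 ⊢
      omega
    · exact hdeg v hv
  · refine ⟨⟨φ (⟨y, hy⟩, false), (hmem _).1⟩, ?_, ?_⟩
    · exact congrArg Prod.fst (hpf ⟨_, (hmem (⟨y, hy⟩, false)).1⟩ ⟨y, hy⟩ rfl)
    · rw [ht₀]
      · exact congrArg Prod.snd (hpf ⟨_, (hmem (⟨y, hy⟩, false)).1⟩ ⟨y, hy⟩ rfl)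
      · rintro y' ⟨h, -⟩
        exact absurd (Prod.ext_iff.1 (hφ h)).2 (by simp)

/-- Every Steiner quadruple system of order at least `14` has a 1-overlap cycle, and the overlap
points can be all the points. -/
theorem IsSQS.exists_ocycle {n : ℕ} {B : Set (Finset V)} (hB : IsSQS n B) (hn : 14 ≤ n) :
    ∃ C : Cycle (List V), IsOcycle 1 B C ∧ ∀ v, IsOverlapPoint C v := by
  classical
  obtain ⟨𝓑, rfl⟩ : ∃ 𝓑 : Finset (Finset V), B = 𝓑 := ⟨B.toFinset, by simp⟩
  have hcard := hB.card_points
  rw [Nat.card_eq_fintype_card] at hcard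
  obtain ⟨x, x', hxx'⟩ := Fintype.one_lt_card_iff.1 (by omega : 1 < Fintype.card V)
  obtain ⟨s, t, hst, heven, hstar⟩ := hB.exists_even_ends hn x
  have : Nonempty 𝓑 := ⟨(hstar x' hxx'.symm).choose⟩
  obtain ⟨L, hall, hnd, hchain⟩ := exists_euler_circuit s t x heven hstar
  have hword : ∀ d : 𝓑 × Bool, ∃ w : List V, w.Nodup ∧ w.toFinset = d.1.1 ∧
      w.take 1 = [dartSrc s t d] ∧ w.rtake 1 = [dartTgt s t d] := by
    rintro ⟨b, o⟩
    obtain ⟨h1, h2, h3⟩ := hst b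
    have hb4 := hB.card_block b.1 (by simp)
    cases o
    · exact exists_string hb4 h2 h1 h3.symm
    · exact exists_string hb4 h1 h2 h3
  choose w hwn hwb hwt hwr using hword
  have hhead : ∀ d ∈ L, IsOverlapPoint ((L : Cycle (𝓑 × Bool)).map w) (dartSrc s t d) := by
    intro d hd
    refine ⟨w d, Cycle.mem_map.2 ⟨d, by simpa using hd, rfl⟩, ?_⟩
    have := hwt d
    rcases hw : w d with _ | ⟨a, l⟩
    · simp [hw] at this
    · simpa [hw] using this
  have hend : ∀ d ∈ L, IsOverlapPoint ((L : Cycle (𝓑 × Bool)).map w) (dartTgt s t d) := by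
    intro d hd
    obtain ⟨l₁, l₂, hl⟩ := List.append_of_mem hd
    have hrot : (L : Cycle (𝓑 × Bool)) =
        ((d :: (l₂ ++ l₁) : List (𝓑 × Bool)) : Cycle (𝓑 × Bool)) := by
      rw [hl, Cycle.coe_eq_coe, ← List.cons_append]
      exact List.isRotated_append
    rw [hrot, Cycle.chain_coe_cons, List.isChain_cons] at hchain
    obtain ⟨d', hd'⟩ : ∃ d', d' ∈ (l₂ ++ l₁ ++ [d]).head? := by
      cases h : (l₂ ++ l₁ ++ [d]).head? with
      | none => simp at h
      | some d' => exact ⟨d', rfl⟩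
    rw [hchain.1 d' hd']
    refine hhead d' ?_
    have := List.mem_of_mem_head? hd'
    rw [hl]
    simp only [List.mem_append, List.mem_cons, List.not_mem_nil, or_false] at this ⊢
    tauto
  refine ⟨(L : Cycle (𝓑 × Bool)).map w, ⟨?_, ?_, ?_, ?_, ?_⟩, fun v => ?_⟩
  · rw [Ne, Cycle.map_eq_nil]
    rintro h
    have := hall (Classical.arbitrary 𝓑)
    rw [Cycle.coe_eq_nil] at h
    simp [h] at this
  · intro u hu
    obtain ⟨d, -, rfl⟩ := Cycle.mem_map.1 hu
    exact hwn d
  · rw [Cycle.map_coe, Cycle.map_coe, Cycle.nodup_coe_iff, List.map_map]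
    have : L.map (List.toFinset ∘ w) = (L.map Prod.fst).map Subtype.val := by
      rw [List.map_map]
      exact List.map_congr_left fun d _ => hwb d
    rw [this]
    exact hnd.map Subtype.val_injective
  · intro b
    constructor
    · intro hb
      obtain ⟨d, hd, hdb⟩ := List.mem_map.1 (hall ⟨b, by simpa using hb⟩)
      exact ⟨w d, Cycle.mem_map.2 ⟨d, by simpa using hd, rfl⟩, by rw [hwb, hdb]⟩
    · rintro ⟨u, hu, rfl⟩
      obtain ⟨d, -, rfl⟩ := Cycle.mem_map.1 hu
      rw [hwb]
      simp
  · rw [Cycle.chain_map]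
    refine hchain.imp fun a b hab => ?_
    rw [hwr, hwt, hab]
  · have hv : ∃ b, s b = v ∨ t b = v := by
      by_cases hvx : v = x
      · obtain ⟨b, hb, -⟩ := hstar x' hxx'.symm
        exact ⟨b, Or.inl (hb.trans hvx.symm)⟩
      · obtain ⟨b, -, hb⟩ := hstar v hvx
        exact ⟨b, Or.inr hb⟩
    obtain ⟨b, hb⟩ := hv
    obtain ⟨⟨b, o⟩, hd, rfl⟩ := List.mem_map.1 (hall b)
    have h1 := hhead _ hd
    have h2 := hend _ hd
    cases o <;> simp only [dartSrc, dartTgt, if_true, Bool.false_eq_true, if_false] at h1 h2 <;>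
      rcases hb with rfl | rfl <;> assumption

end Ocycle

/-! ### Existence of the systems of pairs -/

section PairSystems

/-- The pairs of distinct elements to which a symmetric edge colouring `col` gives the colour
`ξ`. -/
def colorClass {A : Type*} (col : A → A → ℕ) (ξ : ℕ) : Set (Sym2 A) :=
  {p | ∃ x y, x ≠ y ∧ p = s(x, y) ∧ col x y = ξ}

section

variable {A : Type*} {col : A → A → ℕ}

theorem mk_mem_colorClass (hcol : ∀ x y, col x y = col y x) {ξ : ℕ} {x y : A} :
    s(x, y) ∈ colorClass col ξ ↔ x ≠ y ∧ col x y = ξ := by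
  constructor
  · rintro ⟨a, b, hab, h, hc⟩
    rcases Sym2.eq_iff.1 h with ⟨rfl, rfl⟩ | ⟨rfl, rfl⟩
    · exact ⟨hab, hc⟩
    · exact ⟨hab.symm, hcol _ _ ▸ hc⟩
  · rintro ⟨h, hc⟩
    exact ⟨x, y, h, rfl, hc⟩

theorem not_isDiag_of_mem_colorClass {ξ : ℕ} {p : Sym2 A} (hp : p ∈ colorClass col ξ) :
    ¬ p.IsDiag := by
  obtain ⟨x, y, hxy, rfl, -⟩ := hp
  simpa using hxy

theorem existsUnique_mem_colorClass (hcol : ∀ x y, col x y = col y x) {ξ : ℕ} {x : A}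
    (h : ∃! y, x ≠ y ∧ col x y = ξ) : ∃! p, p ∈ colorClass col ξ ∧ x ∈ p := by
  obtain ⟨y, hy, hu⟩ := h
  refine ⟨s(x, y), ⟨(mk_mem_colorClass hcol).2 hy, Sym2.mem_mk_left x y⟩, ?_⟩
  rintro p ⟨hp, hx⟩
  obtain ⟨z, rfl⟩ := Sym2.mem_iff_exists.1 hx
  rw [hu z ((mk_mem_colorClass hcol).1 hp)]

theorem existsUnique_color (hcol : ∀ x y, col x y = col y x) {P : ℕ → Prop}
    (hP : ∀ x y, P (col x y)) (p : Sym2 A) (hp : ¬ p.IsDiag) :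
    ∃! ξ, P ξ ∧ p ∈ colorClass col ξ := by
  induction p using Sym2.ind with
  | _ x y =>
    rw [Sym2.mk_isDiag_iff] at hp
    exact ⟨col x y, ⟨hP x y, (mk_mem_colorClass hcol).2 ⟨hp, rfl⟩⟩,
      fun ξ hξ => ((mk_mem_colorClass hcol).1 hξ.2).2.symm⟩

end

/-- The edge colouring of the complete graph on `ZMod m` and a point at infinity by the sums of the
end points, where the infinite point paired with `a` counts as another `a`. -/
def optionSum {m : ℕ} : Option (ZMod m) → Option (ZMod m) → ZMod m
  | some a, some b => a + b
  | some a, none => a + a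
  | none, some b => b + b
  | none, none => 0

theorem optionSum_comm {m : ℕ} (a b : Option (ZMod m)) : optionSum a b = optionSum b a := by
  cases a <;> cases b <;> simp [optionSum, add_comm]

theorem existsUnique_optionSum {k : ℕ} (hk : 0 < k) (x : Option (ZMod (2 * k - 1)))
    (s : ZMod (2 * k - 1)) : ∃! y, x ≠ y ∧ optionSum x y = s := by
  have h2 : (2 : ZMod (2 * k - 1)) * k = 1 := by
    have : ((2 * k - 1 + 1 : ℕ) : ZMod (2 * k - 1)) = 1 := by
      rw [Nat.cast_add, ZMod.natCast_self, zero_add, Nat.cast_one]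
    rw [Nat.sub_add_cancel (by omega)] at this
    exact_mod_cast this
  have hinj : ∀ a b : ZMod (2 * k - 1), a + a = b + b → a = b := by
    intro a b h
    linear_combination (k : ZMod (2 * k - 1)) * h + (b - a) * h2
  have hhalf : s * k + s * k = s := by linear_combination s * h2
  cases x with
  | none =>
    refine ⟨some (s * k), ⟨by simp, hhalf⟩, ?_⟩
    rintro (_ | b) ⟨hb, h⟩
    · exact absurd rfl hb
    · exact congrArg some (hinj _ _ (h.trans hhalf.symm))
  | some a =>
    by_cases ha : a + a = s
    · refine ⟨none, ⟨by simp, ha⟩, ?_⟩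
      rintro (_ | b) ⟨hb, h⟩
      · rfl
      · exact absurd (congrArg some (add_left_cancel (ha.trans h.symm))) hb
    · refine ⟨some (s - a), ⟨fun h => ha ?_, add_sub_cancel a s⟩, ?_⟩
      · exact eq_sub_iff_add_eq.1 (Option.some.inj h)
      · rintro (_ | b) ⟨hb, h⟩
        · exact absurd h ha
        · exact congrArg some (eq_sub_of_add_eq' h)

theorem Hanani.exists_isPairSystem {k : ℕ} (hk : 0 < k) : ∃ P, Hanani.IsPairSystem k P := by
  have : NeZero (2 * k) := ⟨by omega⟩
  have : NeZero (2 * k - 1) := ⟨by omega⟩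
  have e : ZMod (2 * k) ≃ Option (ZMod (2 * k - 1)) := Fintype.equivOfCardEq (by
    rw [Fintype.card_option, ZMod.card, ZMod.card]
    omega)
  let col : ZMod (2 * k) → ZMod (2 * k) → ℕ := fun x y => (optionSum (e x) (e y)).val
  have hcol : ∀ x y, col x y = col y x := fun x y => by simp only [col, optionSum_comm]
  have hlt : ∀ x y, col x y + 1 < 2 * k := fun x y => by
    have := ZMod.val_lt (optionSum (e x) (e y))
    simp only [col]
    omega
  refine ⟨colorClass col, fun α _ p hp => not_isDiag_of_mem_colorClass hp, fun α hα x =>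
    existsUnique_mem_colorClass hcol ?_, existsUnique_color hcol hlt⟩
  obtain ⟨y, ⟨hy, hs⟩, hu⟩ := existsUnique_optionSum hk (e x) (α : ZMod (2 * k - 1))
  have hval : ((α : ℕ) : ZMod (2 * k - 1)).val = α := ZMod.val_cast_of_lt (by omega)
  refine ⟨e.symm y, ⟨fun h => hy (by rw [h, e.apply_symm_apply]), ?_⟩, ?_⟩
  · simp only [col, e.apply_symm_apply, hs, hval]
  · rintro z ⟨hz, hc⟩
    rw [e.eq_symm_apply]
    refine hu _ ⟨fun h => hz (e.injective h), ?_⟩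
    rw [← hc, ZMod.natCast_zmod_val]

/-- The relabelling `2j ↦ j`, `2j + 1 ↦ j + k` (`0 ≤ j < k`) of the residues modulo `2k`. -/
def halve (k : ℕ) (x : ZMod (2 * k)) : ZMod (2 * k) :=
  ((x.val / 2 + k * (x.val % 2) : ℕ) : ZMod (2 * k))

theorem ZMod.eq_natCast_iff_val_eq {n m : ℕ} [NeZero n] (hm : m < n) (s : ZMod n) :
    s = (m : ZMod n) ↔ s.val = m := by
  rw [← ZMod.val_cast_of_lt hm, (ZMod.val_injective n).eq_iff, ZMod.natCast_zmod_val]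

theorem halve_bijective {k : ℕ} (hk : 0 < k) : Function.Bijective (halve k) := by
  have : NeZero (2 * k) := ⟨by omega⟩
  refine Finite.injective_iff_bijective.1 fun x y h => ?_
  have hx := ZMod.val_lt x
  have hy := ZMod.val_lt y
  have hval : ∀ m < 2 * k, m / 2 + k * (m % 2) < 2 * k := fun m hm => by
    rcases Nat.mod_two_eq_zero_or_one m with h | h <;> rw [h] <;> omega
  have h' := congrArg ZMod.val h
  rw [halve, halve, ZMod.val_cast_of_lt (hval _ hx), ZMod.val_cast_of_lt (hval _ hy)] at h'
  apply ZMod.val_injective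
  rcases Nat.mod_two_eq_zero_or_one x.val with h1 | h1 <;>
    rcases Nat.mod_two_eq_zero_or_one y.val with h2 | h2 <;> rw [h1, h2] at h' <;> omega

theorem halve_add_self {k : ℕ} (x : ZMod (2 * k)) :
    halve k x + halve k x = ((2 * (x.val / 2) : ℕ) : ZMod (2 * k)) := by
  rw [halve, ← Nat.cast_add, show x.val / 2 + k * (x.val % 2) + (x.val / 2 + k * (x.val % 2)) =
    2 * (x.val / 2) + 2 * k * (x.val % 2) by ring, Nat.cast_add, Nat.cast_mul (2 * k),
    ZMod.natCast_self, zero_mul, add_zero]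

/-- Pairs are classified by the sum of their elements: an odd sum gives a partition of all the
residues into pairs, while an even sum `2ξ` leaves out `ξ` and `ξ + k`, which are the
images of `2ξ` and `2ξ + 1` under the relabelling. -/
theorem Hanani.exists_isBarPairSystem {k : ℕ} (hk : 0 < k) : ∃ Q, Hanani.IsBarPairSystem k Q := by
  have : NeZero (2 * k) := ⟨by omega⟩
  let ρ := halve k
  have hρ : Function.Bijective ρ := halve_bijective hk
  let col : ZMod (2 * k) → ZMod (2 * k) → ℕ := fun x y =>
    (ρ x + ρ y).val / 2 + k * ((ρ x + ρ y).val % 2)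
  have hcol : ∀ x y, col x y = col y x := fun x y => by simp only [col, add_comm]
  have hlow : ∀ ξ < k, ∀ x y, col x y = ξ ↔ ρ x + ρ y = ((2 * ξ : ℕ) : ZMod (2 * k)) := by
    intro ξ hξ x y
    rw [ZMod.eq_natCast_iff_val_eq (by omega)]
    have := ZMod.val_lt (ρ x + ρ y)
    simp only [col]
    rcases Nat.mod_two_eq_zero_or_one (ρ x + ρ y).val with h | h <;> rw [h] <;> omega
  have hhigh : ∀ ξ < k, ∀ x y, col x y = k + ξ ↔
      ρ x + ρ y = ((2 * ξ + 1 : ℕ) : ZMod (2 * k)) := by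
    intro ξ hξ x y
    rw [ZMod.eq_natCast_iff_val_eq (by omega)]
    have := ZMod.val_lt (ρ x + ρ y)
    simp only [col]
    rcases Nat.mod_two_eq_zero_or_one (ρ x + ρ y).val with h | h <;> rw [h] <;> omega
  have hlt : ∀ x y, col x y < 2 * k := by
    intro x y
    have := ZMod.val_lt (ρ x + ρ y)
    simp only [col]
    rcases Nat.mod_two_eq_zero_or_one (ρ x + ρ y).val with h | h <;> rw [h] <;> omega
  have hself : ∀ m < 2 * k, ∀ x, ρ x + ρ x = (m : ZMod (2 * k)) ↔ 2 * (x.val / 2) = m := by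
    intro m hm x
    have hx := ZMod.val_lt x
    rw [show ρ x + ρ x = _ from halve_add_self x, ZMod.eq_natCast_iff_val_eq hm,
      ZMod.val_cast_of_lt (by omega)]
  have hdouble : ∀ ξ < k, ∀ x : ZMod (2 * k), ρ x + ρ x = ((2 * ξ : ℕ) : ZMod (2 * k)) ↔
      x = 2 * ξ ∨ x = 2 * ξ + 1 := by
    intro ξ hξ x
    rw [hself _ (by omega),
      show (2 * ξ : ZMod (2 * k)) = ((2 * ξ : ℕ) : ZMod (2 * k)) by push_cast; rfl,
      show ((2 * ξ : ℕ) : ZMod (2 * k)) + 1 = ((2 * ξ + 1 : ℕ) : ZMod (2 * k)) by push_cast; rfl,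
      ZMod.eq_natCast_iff_val_eq (by omega), ZMod.eq_natCast_iff_val_eq (by omega)]
    omega
  have hex : ∀ x s, ρ x + ρ x ≠ s → ∃! y, x ≠ y ∧ ρ x + ρ y = s := by
    intro x s hxs
    obtain ⟨y, hy⟩ := hρ.2 (s - ρ x)
    refine ⟨y, ⟨?_, by rw [hy, add_sub_cancel]⟩, fun z hz => hρ.1 ?_⟩
    · rintro rfl
      exact hxs (eq_sub_iff_add_eq.1 hy)
    · rw [hy, eq_sub_iff_add_eq', hz.2]
  have homit : ∀ ξ < k, ∀ p ∈ colorClass col ξ, ∀ x ∈ p,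
      ρ x + ρ x ≠ ((2 * ξ : ℕ) : ZMod (2 * k)) := by
    intro ξ hξ p hp x hx h
    obtain ⟨y, rfl⟩ := Sym2.mem_iff_exists.1 hx
    obtain ⟨hxy, hc⟩ := (mk_mem_colorClass hcol).1 hp
    exact hxy (hρ.1 (add_left_cancel (h.trans ((hlow ξ hξ x y).1 hc).symm)))
  refine ⟨colorClass col, fun ξ _ p hp => not_isDiag_of_mem_colorClass hp, ?_, ?_, ?_, ?_,
    existsUnique_color hcol hlt⟩
  · intro ξ hξ p hp hmem
    exact homit ξ hξ p hp _ hmem ((hdouble ξ hξ _).2 (Or.inl rfl))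
  · intro ξ hξ p hp hmem
    exact homit ξ hξ p hp _ hmem ((hdouble ξ hξ _).2 (Or.inr rfl))
  · intro ξ hξ x h1 h2
    refine existsUnique_mem_colorClass hcol ?_
    simp only [hlow ξ hξ]
    exact hex x _ fun h => ((hdouble ξ hξ x).1 h).elim h1 h2
  · intro ξ hξ x
    refine existsUnique_mem_colorClass hcol ?_
    simp only [hhigh ξ hξ]
    exact hex x _ fun h => by
      rw [hself _ (by omega)] at h
      omega

end PairSystems

/-! ### The blocks of Hanani's construction -/

namespace Hanani

variable {k : ℕ}

theorem zmod_two_eq_zero_or_one (i : ZMod 2) : i = 0 ∨ i = 1 := by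
  decide +revert

/-- The parity of a residue modulo `2k`. -/
def parity : ZMod (2 * k) →+* ZMod 2 := ZMod.castHom (dvd_mul_right 2 k) (ZMod 2)

/-- The index `c`, `0 ≤ c < k`, of the pair `{2c, 2c + 1}` to which a residue belongs. -/
def half (x : ZMod (2 * k)) : ℕ := x.val / 2

/-- The residue `y` with `x + y + 2c + ε = 0`. All blocks of types 2 to 9 contain `h0x` and `h1y`
for some `h`, `x` and `y = mate c ε x`, with `c` corresponding to `c₃`. -/
def mate (c : ℕ) (ε : ZMod 2) (x : ZMod (2 * k)) : ZMod (2 * k) := -(x + 2 * c + ε.val)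

theorem mate_mate (c : ℕ) (ε : ZMod 2) (x : ZMod (2 * k)) : mate c ε (mate c ε x) = x := by
  unfold mate
  ring

theorem parity_two : parity (2 : ZMod (2 * k)) = 0 := by
  rw [map_ofNat]
  rfl

theorem parity_mate (c : ℕ) (ε : ZMod 2) (x : ZMod (2 * k)) :
    parity (mate c ε x) = parity x + ε := by
  rw [mate, map_neg, map_add, map_add, map_mul, map_natCast, map_natCast, parity_two,
    ZMod.natCast_zmod_val, ZMod.neg_eq_self_mod_two]
  ring

section

variable [NeZero (2 * k)]

theorem val_parity (x : ZMod (2 * k)) : (parity x).val = x.val % 2 := by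
  conv_lhs => rw [← ZMod.natCast_zmod_val x, map_natCast]
  rw [ZMod.val_natCast]

theorem eq_two_mul_half_add (x : ZMod (2 * k)) : x = 2 * half x + (parity x).val := by
  rw [val_parity, half]
  conv_lhs => rw [← ZMod.natCast_zmod_val x, ← Nat.div_add_mod x.val 2]
  push_cast
  rfl

theorem half_lt (x : ZMod (2 * k)) : half x < k := by
  have := ZMod.val_lt x
  unfold half
  omega

theorem exists_mate_eq (x y : ZMod (2 * k)) : ∃ c < k, ∃ ε, y = mate c ε x := by
  refine ⟨_, half_lt (-(x + y)), parity (-(x + y)), ?_⟩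
  have := eq_two_mul_half_add (-(x + y))
  unfold mate
  linear_combination -this

theorem half_eq_iff {c : ℕ} (hc : c < k) (z : ZMod (2 * k)) :
    half z = c ↔ z = 2 * c ∨ z = 2 * c + 1 := by
  rw [show (2 * c : ZMod (2 * k)) = ((2 * c : ℕ) : ZMod (2 * k)) by push_cast; rfl,
    show ((2 * c : ℕ) : ZMod (2 * k)) + 1 = ((2 * c + 1 : ℕ) : ZMod (2 * k)) by push_cast; rfl,
    ZMod.eq_natCast_iff_val_eq (by omega), ZMod.eq_natCast_iff_val_eq (by omega), half]
  omega

end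

theorem two_mul_intCast_eq_zero {a : ℤ} (ha : a ≡ 0 [ZMOD k]) : (2 * a : ZMod (2 * k)) = 0 := by
  have : ((2 * a : ℤ) : ZMod (2 * k)) = 0 := by
    rw [ZMod.intCast_zmod_eq_zero_iff_dvd]
    push_cast
    exact mul_dvd_mul_left 2 (Int.modEq_zero_iff_dvd.1 ha)
  exact_mod_cast this

variable {X : Type*} {e : X ≃ Label k} {B : Set (Finset X)}
  {P Q : ℕ → Set (Sym2 (ZMod (2 * k)))}

theorem params_val (a c : ℤ) (ε : ZMod 2) : Params k a (-a - c) c ε.val := by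
  refine ⟨by ring_nf; rfl, ?_⟩
  rcases zmod_two_eq_zero_or_one ε with rfl | rfl
  · exact Or.inl rfl
  · exact Or.inr rfl

section

variable [NeZero (2 * k)]

/-- The blocks of types 2 to 5: for `h = 0` these are types 2 and 3, and for `h = 1` types 4 and 5,
according to the parity of `x`. -/
theorem block_inf (h ε : ZMod 2) (x z : ZMod (2 * k)) :
    Block e B P Q {inf (parity x + parity z + h), pt h 0 x, pt h 1 (mate (half z) ε x),
      pt (h + 1) ε z} := by
  have hx := eq_two_mul_half_add x
  have hz := eq_two_mul_half_add z
  have hε : (((ε.val : ℤ)) : ZMod 2) = ε := by simp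
  have hc := params_val (k := k) (half x) (half z) ε
  have hm : mate (half z) ε x = -(x + 2 * half z + ε.val) := rfl
  have h11 : (1 : ZMod 2) + 1 = 0 := rfl
  have hv1 : ((1 : ZMod 2).val) = 1 := rfl
  have hv0 : ((0 : ZMod 2).val) = 0 := rfl
  rcases zmod_two_eq_zero_or_one h with rfl | rfl <;>
  rcases zmod_two_eq_zero_or_one (parity x) with px | px <;>
  rcases zmod_two_eq_zero_or_one (parity z) with pz | pz <;>
  rw [px] at hx <;> rw [pz] at hz <;>
  simp only [px, pz, hv0, hv1, Nat.cast_zero, Nat.cast_one, add_zero, zero_add, h11] at hx hz ⊢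
  · have := Block.type2 (e := e) (B := B) (P := P) (Q := Q) _ _ _ _ 0 hc (by simp)
    rw [hε] at this
    convert this using 6
    on_goal 1 => simp
    all_goals push_cast
    exacts [by linear_combination hx, by linear_combination hm - hx, by linear_combination hz]
  · have := Block.type2 (e := e) (B := B) (P := P) (Q := Q) _ _ _ _ 1 hc (by simp)
    rw [hε] at this
    convert this using 6
    on_goal 1 => simp
    all_goals push_cast
    exacts [by linear_combination hx, by linear_combination hm - hx, by linear_combination hz]
  · have := Block.type3 (e := e) (B := B) (P := P) (Q := Q) _ _ _ _ 1 hc (by simp)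
    rw [hε] at this
    convert this using 6
    on_goal 1 => simp
    all_goals push_cast
    exacts [by linear_combination hx, by linear_combination hm - hx, by linear_combination hz]
  · have := Block.type3 (e := e) (B := B) (P := P) (Q := Q) _ _ _ _ 0 hc (by simp)
    rw [hε] at this
    convert this using 6
    on_goal 1 => simp
    all_goals push_cast
    exacts [by linear_combination hx, by linear_combination hm - hx, by linear_combination hz]
  · have := Block.type4 (e := e) (B := B) (P := P) (Q := Q) _ _ _ _ 1 hc (by simp)
    rw [hε] at this
    convert this using 6
    on_goal 1 => simp
    all_goals push_cast
    exacts [by linear_combination hx, by linear_combination hm - hx, by linear_combination hz]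
  · have := Block.type4 (e := e) (B := B) (P := P) (Q := Q) _ _ _ _ 0 hc (by simp)
    rw [hε] at this
    convert this using 6
    on_goal 1 => simp
    all_goals push_cast
    exacts [by linear_combination hx, by linear_combination hm - hx, by linear_combination hz]
  · have := Block.type5 (e := e) (B := B) (P := P) (Q := Q) _ _ _ _ 0 hc (by simp)
    rw [hε] at this
    convert this using 6
    on_goal 1 => simp
    all_goals push_cast
    exacts [by linear_combination hx, by linear_combination hm - hx, by linear_combination hz]
  · have := Block.type5 (e := e) (B := B) (P := P) (Q := Q) _ _ _ _ 1 hc (by simp)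
    rw [hε] at this
    convert this using 6
    on_goal 1 => simp
    all_goals push_cast
    exacts [by linear_combination hx, by linear_combination hm - hx, by linear_combination hz]

/-- The blocks of types 6 (`ε = 0`) and 7 (`ε = 1`). -/
theorem block_low {h ε : ZMod 2} {x r s : ZMod (2 * k)} {c : ℕ} (hc : c < k)
    (hrs : s(r, s) ∈ Q c) :
    Block e B P Q {pt h 0 x, pt h 1 (mate c ε x), pt (h + 1) ε r, pt (h + 1) ε s} := by
  have hx := eq_two_mul_half_add x
  have hm : mate c ε x = -(x + 2 * c + ε.val) := rfl
  have hv1 : ((1 : ZMod 2).val) = 1 := rfl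
  have hv0 : ((0 : ZMod 2).val) = 0 := rfl
  rcases zmod_two_eq_zero_or_one ε with rfl | rfl
  · have := Block.type6 (e := e) (B := B) (P := P) h _ _ c _
      (params_val (k := k) (half x) c (parity x)) hc r s hrs
    rw [hv0] at hm
    convert this using 5
    all_goals push_cast at hm ⊢
    exacts [by linear_combination hx, by linear_combination hm - hx]
  · rcases zmod_two_eq_zero_or_one (parity x) with px | px
    · have := Block.type7 (e := e) (B := B) (P := P) h _ _ c _
        (params_val (k := k) (half x) c 1) hc r s hrs
      rw [px, hv0] at hx
      rw [hv1] at hm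
      convert this using 5
      all_goals rw [hv1]; push_cast at hx hm ⊢
      exacts [by linear_combination hx, by linear_combination hm - hx]
    · have := Block.type7 (e := e) (B := B) (P := P) h _ _ c _
        (params_val (k := k) (half x + 1) c 0) hc r s hrs
      rw [px, hv1] at hx
      rw [hv1] at hm
      convert this using 5
      all_goals rw [hv0]; push_cast at hx hm ⊢
      exacts [by linear_combination hx, by linear_combination hm - hx]

/-- The blocks of types 8 (`ε = 0`) and 9 (`ε = 1`). -/
theorem block_high {h ε : ZMod 2} {x r s : ZMod (2 * k)} {c : ℕ} (hc : c < k)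
    (hrs : s(r, s) ∈ Q (k + c)) :
    Block e B P Q {pt h 0 x, pt h 1 (mate c ε x), pt (h + 1) (ε + 1) r, pt (h + 1) (ε + 1) s} := by
  have hx := eq_two_mul_half_add x
  have hm : mate c ε x = -(x + 2 * c + ε.val) := rfl
  have hv1 : ((1 : ZMod 2).val) = 1 := rfl
  have hv0 : ((0 : ZMod 2).val) = 0 := rfl
  rcases zmod_two_eq_zero_or_one ε with rfl | rfl
  · have := Block.type8 (e := e) (B := B) (P := P) h _ _ c _
      (params_val (k := k) (half x) c (parity x)) hc r s hrs
    rw [zero_add]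
    rw [hv0] at hm
    convert this using 5
    all_goals push_cast at hm ⊢
    exacts [by linear_combination hx, by linear_combination hm - hx]
  · rw [show (1 : ZMod 2) + 1 = 0 from rfl]
    rcases zmod_two_eq_zero_or_one (parity x) with px | px
    · have := Block.type9 (e := e) (B := B) (P := P) h _ _ c _
        (params_val (k := k) (half x) c 1) hc r s hrs
      rw [px, hv0] at hx
      rw [hv1] at hm
      convert this using 5
      all_goals rw [hv1]; push_cast at hx hm ⊢
      exacts [by linear_combination hx, by linear_combination hm - hx]
    · have := Block.type9 (e := e) (B := B) (P := P) h _ _ c _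
        (params_val (k := k) (half x + 1) c 0) hc r s hrs
      rw [px, hv1] at hx
      rw [hv1] at hm
      convert this using 5
      all_goals rw [hv0]; push_cast at hx hm ⊢
      exacts [by linear_combination hx, by linear_combination hm - hx]

end

end Hanani

/-! ### Every triple is covered -/

namespace Hanani

variable {k : ℕ} {X : Type*} {e : X ≃ Label k} {B : Set (Finset X)}
  {P Q : ℕ → Set (Sym2 (ZMod (2 * k)))}

/-- Some block contains the three given points. -/
def Covered (e : X ≃ Label k) (B : Set (Finset X)) (P Q : ℕ → Set (Sym2 (ZMod (2 * k))))
    (p q r : Point k) : Prop :=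
  ∃ b, Block e B P Q b ∧ p ∈ b ∧ q ∈ b ∧ r ∈ b

theorem Covered.swap {p q r : Point k} (h : Covered e B P Q p q r) : Covered e B P Q q p r := by
  obtain ⟨b, hb, h1, h2, h3⟩ := h
  exact ⟨b, hb, h2, h1, h3⟩

theorem Covered.swap_right {p q r : Point k} (h : Covered e B P Q p q r) :
    Covered e B P Q p r q := by
  obtain ⟨b, hb, h1, h2, h3⟩ := h
  exact ⟨b, hb, h1, h3, h2⟩

/-- The points `A0`, `A1` and those with a given prefix form a copy of the given system. -/
theorem covered_lift {n : ℕ} (hB : IsSQS n B) (h i : ZMod 2) {u v w : Label k} (huv : u ≠ v)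
    (huw : u ≠ w) (hvw : v ≠ w) : Covered e B P Q (lift h i u) (lift h i v) (lift h i w) := by
  classical
  obtain ⟨b, ⟨hb, hsub⟩, -⟩ := hB.triple {e.symm u, e.symm v, e.symm w}
    (Finset.card_eq_three.2 ⟨_, _, _, by simpa using huv, by simpa using huw,
      by simpa using hvw, rfl⟩)
  simp only [Finset.insert_subset_iff, Finset.singleton_subset_iff] at hsub
  refine ⟨_, Block.type1 h i b hb, ?_, ?_, ?_⟩ <;> rw [Finset.mem_image]
  · exact ⟨_, hsub.1, by simp⟩
  · exact ⟨_, hsub.2.1, by simp⟩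
  · exact ⟨_, hsub.2.2, by simp⟩

section

variable [NeZero (2 * k)]

theorem exists_half_parity {c : ℕ} (hc : c < k) (δ : ZMod 2) :
    ∃ z : ZMod (2 * k), half z = c ∧ parity z = δ := by
  have hδ := ZMod.val_lt δ
  have hval : (((2 * c + δ.val : ℕ) : ZMod (2 * k))).val = 2 * c + δ.val :=
    ZMod.val_cast_of_lt (by omega)
  refine ⟨((2 * c + δ.val : ℕ) : ZMod (2 * k)), ?_, ZMod.val_injective 2 ?_⟩
  · rw [half, hval]
    omega
  · rw [val_parity, hval]
    omega

theorem covered_inf_same (l h : ZMod 2) (x y : ZMod (2 * k)) :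
    Covered e B P Q (inf l) (pt h 0 x) (pt h 1 y) := by
  obtain ⟨c, hc, ε, rfl⟩ := exists_mate_eq x y
  obtain ⟨z, rfl, hz⟩ := exists_half_parity hc (l + parity x + h)
  refine ⟨_, block_inf h ε x z, ?_, by simp, by simp⟩
  have : ∀ a b c : ZMod 2, a + (b + a + c) + c = b := by decide
  rw [hz, this]
  simp

/-- The blocks of types 2 to 5 that contain two points with the first coordinate `h` cover half
of the triples `Aℓ`, `hix`, `(h+1)jz`. The other half are covered by those that contain two points
with the first coordinate `h + 1`. -/
theorem covered_inf_cross_of_parity {l h i j : ZMod 2} {x z : ZMod (2 * k)}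
    (hz : parity z = parity x + i * j + l + h) :
    Covered e B P Q (inf l) (pt h i x) (pt (h + 1) j z) := by
  rcases zmod_two_eq_zero_or_one i with rfl | rfl
  · refine ⟨_, block_inf h j x z, ?_, by simp, by simp⟩
    have : ∀ a j b c : ZMod 2, a + (a + 0 * j + b + c) + c = b := by decide
    rw [hz, this]
    simp
  · refine ⟨_, block_inf h j (mate (half z) j x) z, ?_, by simp [mate_mate], by simp⟩
    have : ∀ a j b c : ZMod 2, a + j + (a + 1 * j + b + c) + c = b := by decide
    rw [hz, parity_mate, this]
    simp

theorem covered_inf_cross (l h i j : ZMod 2) (x z : ZMod (2 * k)) :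
    Covered e B P Q (inf l) (pt h i x) (pt (h + 1) j z) := by
  by_cases hz : parity z = parity x + i * j + l + h
  · exact covered_inf_cross_of_parity hz
  · have h1 : ∀ a b i j l h : ZMod 2, ¬ b = a + i * j + l + h → a = b + j * i + l + (h + 1) := by
      decide
    have h2 : h + 1 + 1 = h := by
      rw [add_assoc, show (1 : ZMod 2) + 1 = 0 from rfl, add_zero]
    -- exchange the roles of the two points
    have := covered_inf_cross_of_parity (e := e) (B := B) (P := P) (Q := Q) (h1 _ _ _ _ _ _ hz)
    rw [h2] at this
    exact this.swap_right

/-- Two points with the same prefix and one with another prefix lie in a block of type 10 or of one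
of the types 6 to 9, depending on whether the first coordinates agree. -/
theorem covered_pair (hP : IsPairSystem k P) (hQ : IsBarPairSystem k Q) {h i h' i' : ZMod 2}
    {r s : ZMod (2 * k)} (hrs : r ≠ s) (hne : ¬ (h' = h ∧ i' = i)) (x : ZMod (2 * k)) :
    Covered e B P Q (pt h i r) (pt h i s) (pt h' i' x) := by
  have h01 : ∀ a b : ZMod 2, a ≠ b → b = a + 1 := by decide
  have h2 : ∀ a : ZMod 2, a + 1 + 1 = a := by decide
  by_cases hh : h' = h
  · subst hh
    have hi := h01 _ _ fun hi => hne ⟨rfl, hi⟩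
    obtain ⟨α, ⟨hα, hmem⟩, -⟩ := hP.pair s(r, s) (by simpa using hrs)
    obtain ⟨p, ⟨hp, hx⟩, -⟩ := hP.cover α hα x
    obtain ⟨x', rfl⟩ := Sym2.mem_iff_exists.1 hx
    rcases zmod_two_eq_zero_or_one i' with rfl | rfl
    · rw [hi]
      exact ⟨_, Block.type10 h' α hα x x' r s hp hmem, by simp, by simp, by simp⟩
    · rw [hi]
      exact ⟨_, Block.type10 h' α hα r s x x' hmem hp, by simp [show (1 : ZMod 2) + 1 = 0 from rfl],
        by simp [show (1 : ZMod 2) + 1 = 0 from rfl], by simp⟩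
  · obtain rfl := h01 _ _ hh
    obtain ⟨ξ, ⟨hξ, hmem⟩, -⟩ := hQ.pair s(r, s) (by simpa using hrs)
    by_cases hξk : ξ < k
    · rcases zmod_two_eq_zero_or_one i' with rfl | rfl
      · exact ⟨_, block_low (h := h') (ε := i) (x := x) hξk hmem, by simp, by simp, by simp⟩
      · exact ⟨_, block_low (h := h') (ε := i) (x := mate ξ i x) hξk hmem, by simp, by simp,
          by simp [mate_mate]⟩
    · obtain ⟨c, rfl⟩ := Nat.exists_eq_add_of_le (not_lt.1 hξk)
      have hc : c < k := by omega
      rcases zmod_two_eq_zero_or_one i' with rfl | rfl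
      · exact ⟨_, block_high (h := h') (ε := i + 1) (x := x) hc hmem, by simp [h2], by simp [h2],
          by simp⟩
      · exact ⟨_, block_high (h := h') (ε := i + 1) (x := mate c (i + 1) x) hc hmem, by simp [h2],
          by simp [h2], by simp [mate_mate]⟩

/-- A third point `(h+1)jz` is either adjoined together with some `Aℓ`, or it belongs to a pair in
`Q c` or `Q (k + c)`, where `c` is determined by the first two points. -/
theorem covered_three (hQ : IsBarPairSystem k Q) (h j : ZMod 2) (x y z : ZMod (2 * k)) :
    Covered e B P Q (pt h 0 x) (pt h 1 y) (pt (h + 1) j z) := by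
  have h01 : ∀ a b : ZMod 2, a ≠ b → a = b + 1 := by decide
  obtain ⟨c, hc, ε, rfl⟩ := exists_mate_eq x y
  by_cases hj : j = ε
  · subst hj
    by_cases hz : half z = c
    · subst hz
      exact ⟨_, block_inf h j x z, by simp, by simp, by simp⟩
    · rw [half_eq_iff hc, not_or] at hz
      obtain ⟨p, ⟨hp, hzp⟩, -⟩ := hQ.cover_low c hc z hz.1 hz.2
      obtain ⟨z', rfl⟩ := Sym2.mem_iff_exists.1 hzp
      exact ⟨_, block_low (h := h) (ε := j) (x := x) hc hp, by simp, by simp, by simp⟩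
  · obtain rfl := h01 _ _ hj
    obtain ⟨p, ⟨hp, hzp⟩, -⟩ := hQ.cover_high c hc z
    obtain ⟨z', rfl⟩ := Sym2.mem_iff_exists.1 hzp
    exact ⟨_, block_high (h := h) (ε := ε) (x := x) hc hp, by simp, by simp, by simp⟩

theorem covered_inf {n : ℕ} (hB : IsSQS n B) (l h i h' i' : ZMod 2) {x y : ZMod (2 * k)}
    (hne : pt h i x ≠ pt h' i' y) : Covered e B P Q (inf l) (pt h i x) (pt h' i' y) := by
  have h01 : ∀ a b : ZMod 2, a ≠ b → b = a + 1 := by decide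
  by_cases hh : h = h'
  · subst hh
    by_cases hi : i = i'
    · subst hi
      exact covered_lift hB h i (u := Sum.inr l) (v := Sum.inl x) (w := Sum.inl y) (by simp)
        (by simp) (fun hxy => hne (by rw [Sum.inl.inj hxy]))
    · obtain rfl := h01 _ _ hi
      rcases zmod_two_eq_zero_or_one i with rfl | rfl
      · exact covered_inf_same l h x y
      · exact (covered_inf_same l h y x).swap_right
  · obtain rfl := h01 _ _ hh
    exact covered_inf_cross l h i i' x y

theorem covered_pt_of_prefix_eq {n : ℕ} (hB : IsSQS n B) (hP : IsPairSystem k P)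
    (hQ : IsBarPairSystem k Q) {h i h' i' : ZMod 2} {x y z : ZMod (2 * k)}
    (h12 : pt h i x ≠ pt h i y) (h13 : pt h i x ≠ pt h' i' z) (h23 : pt h i y ≠ pt h' i' z) :
    Covered e B P Q (pt h i x) (pt h i y) (pt h' i' z) := by
  have hinj : ∀ {a b : ZMod (2 * k)}, pt h i a ≠ pt h i b → a ≠ b := fun hab h => hab (h ▸ rfl)
  by_cases hne : h' = h ∧ i' = i
  · obtain ⟨rfl, rfl⟩ := hne
    exact covered_lift hB h' i' (u := Sum.inl x) (v := Sum.inl y) (w := Sum.inl z)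
      (by simpa using hinj h12) (by simpa using hinj h13) (by simpa using hinj h23)
  · exact covered_pair hP hQ (hinj h12) hne z

theorem covered_pt_of_head_eq {n : ℕ} (hB : IsSQS n B) (hP : IsPairSystem k P)
    (hQ : IsBarPairSystem k Q) {h i₁ i₂ h₃ i₃ : ZMod 2} {x y z : ZMod (2 * k)}
    (h12 : pt h i₁ x ≠ pt h i₂ y) (h13 : pt h i₁ x ≠ pt h₃ i₃ z) (h23 : pt h i₂ y ≠ pt h₃ i₃ z) :
    Covered e B P Q (pt h i₁ x) (pt h i₂ y) (pt h₃ i₃ z) := by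
  have h01 : ∀ a b : ZMod 2, a ≠ b → b = a + 1 := by decide
  have h2 : ∀ a b c : ZMod 2, a ≠ b → c = a ∨ c = b := by decide
  by_cases hi : i₁ = i₂
  · subst hi
    exact covered_pt_of_prefix_eq hB hP hQ h12 h13 h23
  by_cases hh : h = h₃
  · subst hh
    rcases h2 i₁ i₂ i₃ hi with rfl | rfl
    · exact (covered_pt_of_prefix_eq hB hP hQ h13 h12 h23.symm).swap_right
    · exact (covered_pt_of_prefix_eq hB hP hQ h23 h12.symm h13.symm).swap_right.swap
  · obtain rfl := h01 _ _ hh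
    obtain rfl := h01 _ _ hi
    rcases zmod_two_eq_zero_or_one i₁ with rfl | rfl
    · exact covered_three hQ h i₃ x y z
    · exact (covered_three hQ h i₃ y x z).swap

/-- Every three points lie in a block. -/
theorem covered_of_ne {n : ℕ} (hB : IsSQS n B) (hP : IsPairSystem k P) (hQ : IsBarPairSystem k Q)
    {p q r : Point k} (hpq : p ≠ q) (hpr : p ≠ r) (hqr : q ≠ r) : Covered e B P Q p q r := by
  have h2 : ∀ a b c : ZMod 2, a = b ∨ a = c ∨ b = c := by decide
  have hinf : ∀ (l l' h i : ZMod 2) (x : ZMod (2 * k)), (inf l : Point k) ≠ inf l' →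
      Covered e B P Q (inf l) (inf l') (pt h i x) := fun l l' h i x hl =>
    covered_lift hB h i (u := Sum.inr l) (v := Sum.inr l') (w := Sum.inl x)
      (fun h => hl (by rw [Sum.inr.inj h])) (by simp) (by simp)
  rcases p with ⟨h₁, i₁, x⟩ | l₁ <;> rcases q with ⟨h₂, i₂, y⟩ | l₂ <;>
    rcases r with ⟨h₃, i₃, z⟩ | l₃
  · rcases h2 h₁ h₂ h₃ with rfl | rfl | rfl
    · exact covered_pt_of_head_eq hB hP hQ hpq hpr hqr
    · exact (covered_pt_of_head_eq hB hP hQ hpr hpq hqr.symm).swap_right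
    · exact (covered_pt_of_head_eq hB hP hQ hqr hpq.symm hpr.symm).swap_right.swap
  · exact (covered_inf hB l₃ _ _ _ _ hpq).swap.swap_right
  · exact (covered_inf hB l₂ _ _ _ _ hpr).swap
  · exact (hinf l₂ l₃ _ _ _ hqr).swap_right.swap
  · exact covered_inf hB l₁ _ _ _ _ hqr
  · exact (hinf l₁ l₃ _ _ _ hpr).swap_right
  · exact hinf l₁ l₂ _ _ _ hpq
  · rcases h2 l₁ l₂ l₃ with rfl | rfl | rfl <;> contradiction

end

end Hanani

/-! ### Counting the blocks of the construction -/

namespace Hanani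

open Finset

/-- A set of disjoint pairs of elements of `S` has at most `|S| / 2` members. -/
theorem two_mul_card_le {A : Type*} [DecidableEq A] (M : Finset (Sym2 A)) (S : Finset A)
    (hd : ∀ p ∈ M, ¬ p.IsDiag) (hS : ∀ p ∈ M, ∀ x ∈ p, x ∈ S)
    (hu : ∀ x, ∀ p ∈ M, ∀ q ∈ M, x ∈ p → x ∈ q → p = q) : 2 * M.card ≤ S.card := by
  have := card_mul_le_card_mul (s := M) (t := S) (m := 2) (n := 1) (fun p x => x ∈ p) ?_ ?_
  · omega
  · intro p hp
    rw [← Sym2.card_toFinset_of_not_isDiag p (hd p hp)]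
    refine card_le_card fun x hx => ?_
    rw [Sym2.mem_toFinset] at hx
    exact mem_filter.2 ⟨hS p hp x hx, hx⟩
  · intro x _
    refine card_le_one.2 fun p hp q hq => ?_
    rw [bipartiteBelow, mem_filter] at hp hq
    exact hu x p hp.1 q hq.1 hp.2 hq.2

variable {k : ℕ} {P Q : ℕ → Set (Sym2 (ZMod (2 * k)))}

section

variable [NeZero (2 * k)]

theorem IsPairSystem.ncard_le (hP : IsPairSystem k P) {α : ℕ} (hα : α + 1 < 2 * k) :
    (P α).ncard ≤ k := by
  classical
  rw [Set.ncard_eq_toFinset_card']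
  have := two_mul_card_le (P α).toFinset univ (fun p hp => hP.not_isDiag α hα p (by simpa using hp))
    (by simp) (fun x p hp q hq hxp hxq => (hP.cover α hα x).unique
      ⟨by simpa using hp, hxp⟩ ⟨by simpa using hq, hxq⟩)
  rw [card_univ, ZMod.card] at this
  omega

theorem IsBarPairSystem.ncard_high_le (hQ : IsBarPairSystem k Q) {c : ℕ} (hc : c < k) :
    (Q (k + c)).ncard ≤ k := by
  classical
  rw [Set.ncard_eq_toFinset_card']
  have := two_mul_card_le (Q (k + c)).toFinset univ
    (fun p hp => hQ.not_isDiag (k + c) (by omega) p (by simpa using hp))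
    (by simp) (fun x p hp q hq hxp hxq => (hQ.cover_high c hc x).unique
      ⟨by simpa using hp, hxp⟩ ⟨by simpa using hq, hxq⟩)
  rw [card_univ, ZMod.card] at this
  omega

theorem IsBarPairSystem.ncard_low_le (hQ : IsBarPairSystem k Q) {c : ℕ} (hc : c < k) :
    (Q c).ncard ≤ k - 1 := by
  classical
  rw [Set.ncard_eq_toFinset_card']
  have hmem : ∀ p ∈ (Q c).toFinset, ∀ x ∈ p, x ≠ 2 * c ∧ x ≠ 2 * c + 1 := by
    intro p hp x hx
    rw [Set.mem_toFinset] at hp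
    exact ⟨fun h => hQ.omit_left c hc p hp (h ▸ hx), fun h => hQ.omit_right c hc p hp (h ▸ hx)⟩
  have := two_mul_card_le (Q c).toFinset
    (univ \ {2 * (c : ZMod (2 * k)), 2 * (c : ZMod (2 * k)) + 1})
    (fun p hp => hQ.not_isDiag c (by omega) p (by simpa using hp))
    (fun p hp x hx => by simpa using hmem p hp x hx)
    (fun x p hp q hq hxp hxq => (hQ.cover_low c hc x (hmem p hp x hxp).1 (hmem p hp x hxp).2).unique
      ⟨by simpa using hp, hxp⟩ ⟨by simpa using hq, hxq⟩)
  have h1 : (2 : ZMod (2 * k)) * c ≠ 2 * c + 1 := by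
    rw [Ne, left_eq_add]
    intro h
    have := congrArg parity h
    simp at this
  rw [card_sdiff_of_subset (subset_univ _), card_univ, ZMod.card, card_pair h1] at this
  omega

end

variable {X : Type*} {e : X ≃ Label k} {B : Set (Finset X)}

/-- The pair of points `hir`, `his` for a pair `{r, s}` of residues. -/
def ptPair (h i : ZMod 2) (p : Sym2 (ZMod (2 * k))) : Finset (Point k) := p.toFinset.image (pt h i)

theorem ptPair_mk (h i : ZMod 2) (r s : ZMod (2 * k)) :
    ptPair h i s(r, s) = {pt h i r, pt h i s} := by
  simp [ptPair, Sym2.toFinset_mk_eq]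

/-- The blocks written in a form that shows how many there are: those of types 2 to 5, 6 and 7, and
8 and 9 are described together. -/
inductive NormalForm (e : X ≃ Label k) (B : Set (Finset X))
    (P Q : ℕ → Set (Sym2 (ZMod (2 * k)))) : Finset (Point k) → Prop
  | lift (h i : ZMod 2) (b : Finset X) (hb : b ∈ B) :
      NormalForm e B P Q (b.image fun x => lift h i (e x))
  | inf (h ε : ZMod 2) (x z : ZMod (2 * k)) :
      NormalForm e B P Q {inf (parity x + parity z + h), pt h 0 x, pt h 1 (mate (half z) ε x),
        pt (h + 1) ε z}
  | low (h ε : ZMod 2) (x : ZMod (2 * k)) (c : ℕ) (hc : c < k) (p : Sym2 (ZMod (2 * k)))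
      (hp : p ∈ Q c) :
      NormalForm e B P Q ({pt h 0 x, pt h 1 (mate c ε x)} ∪ ptPair (h + 1) ε p)
  | high (h ε : ZMod 2) (x : ZMod (2 * k)) (c : ℕ) (hc : c < k) (p : Sym2 (ZMod (2 * k)))
      (hp : p ∈ Q (k + c)) :
      NormalForm e B P Q ({pt h 0 x, pt h 1 (mate c ε x)} ∪ ptPair (h + 1) (ε + 1) p)
  | pairs (h : ZMod 2) (α : ℕ) (hα : α + 1 < 2 * k) (p q : Sym2 (ZMod (2 * k))) (hp : p ∈ P α)
      (hq : q ∈ P α) : NormalForm e B P Q (ptPair h 0 p ∪ ptPair h 1 q)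

theorem union_ptPair_mk (a b : Point k) (h i : ZMod 2) (r s : ZMod (2 * k)) :
    {a, b} ∪ ptPair h i s(r, s) = {a, b, pt h i r, pt h i s} := by
  rw [ptPair_mk, insert_union, singleton_union]

theorem NormalForm.inf_of_eq [NeZero (2 * k)] {h h' ε l : ZMod 2} {x y z : ZMod (2 * k)}
    (hh : h' = h + 1) (hl : l = parity x + parity z + h)
    (hy : x + y + (z - (parity z).val) + ε.val = 0) :
    NormalForm e B P Q {Hanani.inf l, pt h 0 x, pt h 1 y, pt h' ε z} := by
  obtain rfl : y = mate (half z) ε x := by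
    unfold mate
    linear_combination hy - eq_two_mul_half_add z
  subst hl hh
  exact .inf h ε x z

theorem NormalForm.low_of_eq {h ε : ZMod 2} {x y r s : ZMod (2 * k)} {c : ℕ} (hc : c < k)
    (hy : x + y + 2 * c + ε.val = 0) (hrs : s(r, s) ∈ Q c) :
    NormalForm e B P Q {pt h 0 x, pt h 1 y, pt (h + 1) ε r, pt (h + 1) ε s} := by
  obtain rfl : y = mate c ε x := by
    unfold mate
    linear_combination hy
  rw [← union_ptPair_mk]
  exact .low h ε x c hc _ hrs

theorem NormalForm.high_of_eq {h ε : ZMod 2} {x y r s : ZMod (2 * k)} {c : ℕ} (hc : c < k)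
    (hy : x + y + 2 * c + ε.val = 0) (hrs : s(r, s) ∈ Q (k + c)) :
    NormalForm e B P Q {pt h 0 x, pt h 1 y, pt (h + 1) (ε + 1) r, pt (h + 1) (ε + 1) s} := by
  obtain rfl : y = mate c ε x := by
    unfold mate
    linear_combination hy
  rw [← union_ptPair_mk]
  exact .high h ε x c hc _ hrs

theorem Block.normalForm [NeZero (2 * k)] {b : Finset (Point k)} (hb : Block e B P Q b) :
    NormalForm e B P Q b := by
  have h2 : parity (2 : ZMod (2 * k)) = 0 := parity_two
  have h11 : (1 : ZMod 2) + 1 = 0 := rfl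
  have hv1 : ((1 : ZMod 2).val) = 1 := rfl
  have hv0 : ((0 : ZMod 2).val) = 0 := rfl
  have hsum : ∀ {c₁ c₂ c₃ ε : ℤ}, Params k c₁ c₂ c₃ ε →
      (2 * (c₁ + c₂ + c₃) : ZMod (2 * k)) = 0 := fun h => by
    have := two_mul_intCast_eq_zero h.1
    push_cast at this
    exact this
  cases hb with
  | type1 h i b hb => exact .lift h i b hb
  | type2 c₁ c₂ c₃ ε l hc hl =>
    have hs := hsum hc
    rcases hc.2 with rfl | rfl <;> rcases hl with rfl | rfl <;>
      refine .inf_of_eq (h := 0) rfl ?_ ?_ <;>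
      simp only [map_add, map_mul, map_one, h2, zero_mul, map_intCast, Int.cast_zero,
        Int.cast_one, zero_add, add_zero, sub_zero, hv0, hv1, Nat.cast_zero,
        Nat.cast_one] <;>
      linear_combination hs
  | type3 c₁ c₂ c₃ ε l hc hl =>
    have hs := hsum hc
    rcases hc.2 with rfl | rfl <;> rcases hl with rfl | rfl <;>
      refine .inf_of_eq (h := 0) rfl ?_ ?_ <;>
      simp only [map_add, map_sub, map_mul, map_one, h2, zero_mul, map_intCast, Int.cast_zero,
        Int.cast_one, zero_add, add_zero, sub_zero, sub_self, h11, hv0, hv1, Nat.cast_zero,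
        Nat.cast_one] <;>
      linear_combination hs
  | type4 c₁ c₂ c₃ ε l hc hl =>
    have hs := hsum hc
    rcases hc.2 with rfl | rfl <;> rcases hl with rfl | rfl <;>
      refine .inf_of_eq (h := 1) rfl ?_ ?_ <;>
      simp only [map_add, map_sub, map_mul, map_one, h2, zero_mul, map_intCast, Int.cast_zero,
        Int.cast_one, zero_add, add_zero, sub_zero, sub_self, h11, hv0, hv1, Nat.cast_zero,
        Nat.cast_one] <;>
      linear_combination hs
  | type5 c₁ c₂ c₃ ε l hc hl =>
    have hs := hsum hc
    rcases hc.2 with rfl | rfl <;> rcases hl with rfl | rfl <;>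
      refine .inf_of_eq (h := 1) rfl ?_ ?_ <;>
      simp only [map_add, map_mul, map_one, h2, zero_mul, map_intCast, Int.cast_zero,
        Int.cast_one, zero_add, add_zero, sub_zero, h11, hv0, hv1, Nat.cast_zero,
        Nat.cast_one] <;>
      linear_combination hs
  | type6 h c₁ c₂ c₃ ε hc h₃ r s hrs => 
    have := hsum hc
    refine .low_of_eq h₃ ?_ hrs
    push_cast at this ⊢
    rw [hv0]
    linear_combination this
  | type7 h c₁ c₂ c₃ ε hc h₃ r s hrs =>
    have := hsum hc
    refine .low_of_eq h₃ ?_ hrs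
    push_cast at this ⊢
    rw [hv1]
    linear_combination this
  | type8 h c₁ c₂ c₃ ε hc h₃ r s hrs => 
    have := hsum hc
    refine .high_of_eq (ε := 0) h₃ ?_ hrs
    push_cast at this ⊢
    rw [hv0]
    linear_combination this
  | type9 h c₁ c₂ c₃ ε hc h₃ r s hrs =>
    have := hsum hc
    refine .high_of_eq (ε := 1) h₃ ?_ hrs
    push_cast at this ⊢
    rw [hv1]
    linear_combination this
  | type10 h α hα r s r' s' hrs hrs' =>
    have := NormalForm.pairs (e := e) (B := B) (P := P) (Q := Q) h α hα _ _ hrs hrs'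
    rw [ptPair_mk, union_ptPair_mk] at this
    exact this

theorem lift_injective (h i : ZMod 2) : Function.Injective (lift h i : Label k → Point k) := by
  rintro (x | l) (y | l') h <;> simp_all [lift, pt, inf]

theorem NormalForm.card_eq {n : ℕ} (hB : IsSQS n B) (hP : IsPairSystem k P)
    (hQ : IsBarPairSystem k Q) {b : Finset (Point k)} (hb : NormalForm e B P Q b) : b.card = 4 := by
  cases hb with
  | lift h i b hb =>
    rw [← hB.card_block b hb]
    exact card_image_of_injective _ ((lift_injective h i).comp e.injective)
  | inf h ε x z => simp [pt, Hanani.inf]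
  | low h ε x c hc p hp =>
    have hd := hQ.not_isDiag c (by omega) p hp
    induction p using Sym2.ind with
    | _ r s =>
      rw [Sym2.mk_isDiag_iff] at hd
      rw [union_ptPair_mk]
      simp [pt, hd]
  | high h ε x c hc p hp =>
    have hd := hQ.not_isDiag (k + c) (by omega) p hp
    induction p using Sym2.ind with
    | _ r s =>
      rw [Sym2.mk_isDiag_iff] at hd
      rw [union_ptPair_mk]
      simp [pt, hd]
  | pairs h α hα p q hp hq =>
    have hdp := hP.not_isDiag α hα p hp
    have hdq := hP.not_isDiag α hα q hq
    induction p using Sym2.ind with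
    | _ r s =>
      induction q using Sym2.ind with
      | _ r' s' =>
        rw [Sym2.mk_isDiag_iff] at hdp hdq
        simp [ptPair_mk, pt, hdp, hdq]

/-- The summands bound the numbers of blocks of type 1, of types 2 to 5, of types 6 and 7, of types
8 and 9, and of type 10. -/
theorem ncard_normalForm_le [NeZero (2 * k)] [Finite X] (hP : IsPairSystem k P)
    (hQ : IsBarPairSystem k Q) :
    {b | NormalForm e B P Q b}.ncard ≤
      4 * B.ncard + 16 * k ^ 2 + 8 * k * (k * (k - 1)) + 8 * k * (k * k) +
        2 * ((2 * k - 1) * (k * k)) := by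
  classical
  have := Fintype.ofFinite X
  let F₁ : Finset (Finset (Point k)) := (univ : Finset (ZMod 2 × ZMod 2)).biUnion fun u =>
    B.toFinset.image fun b => b.image fun x => lift u.1 u.2 (e x)
  let F₂ : Finset (Finset (Point k)) :=
    (univ : Finset (ZMod 2 × ZMod 2 × ZMod (2 * k) × ZMod (2 * k))).image fun u =>
      {inf (parity u.2.2.1 + parity u.2.2.2 + u.1), pt u.1 0 u.2.2.1,
        pt u.1 1 (mate (half u.2.2.2) u.2.1 u.2.2.1), pt (u.1 + 1) u.2.1 u.2.2.2}
  let F₃ : Finset (Finset (Point k)) :=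
    (univ : Finset (ZMod 2 × ZMod 2 × ZMod (2 * k))).biUnion fun u => (range k).biUnion fun c =>
      (Q c).toFinset.image fun p =>
        {pt u.1 0 u.2.2, pt u.1 1 (mate c u.2.1 u.2.2)} ∪ ptPair (u.1 + 1) u.2.1 p
  let F₄ : Finset (Finset (Point k)) :=
    (univ : Finset (ZMod 2 × ZMod 2 × ZMod (2 * k))).biUnion fun u => (range k).biUnion fun c =>
      (Q (k + c)).toFinset.image fun p =>
        {pt u.1 0 u.2.2, pt u.1 1 (mate c u.2.1 u.2.2)} ∪ ptPair (u.1 + 1) (u.2.1 + 1) p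
  let F₅ : Finset (Finset (Point k)) :=
    (univ : Finset (ZMod 2)).biUnion fun h => (range (2 * k - 1)).biUnion fun α =>
      ((P α).toFinset ×ˢ (P α).toFinset).image fun p => ptPair h 0 p.1 ∪ ptPair h 1 p.2
  have hsub : {b | NormalForm e B P Q b} ⊆ ((F₁ ∪ F₂ ∪ F₃ ∪ F₄ ∪ F₅ : Finset _) : Set _) := by
    intro b hb
    simp only [coe_union, Set.mem_union, mem_coe]
    cases hb with
    | lift h i b hb =>
      refine .inl (.inl (.inl (.inl ?_)))
      exact mem_biUnion.2 ⟨(h, i), mem_univ _, mem_image.2 ⟨b, by simpa using hb, rfl⟩⟩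
    | inf h ε x z =>
      refine .inl (.inl (.inl (.inr ?_)))
      exact mem_image.2 ⟨(h, ε, x, z), mem_univ _, rfl⟩
    | low h ε x c hc p hp =>
      refine .inl (.inl (.inr ?_))
      exact mem_biUnion.2 ⟨(h, ε, x), mem_univ _, mem_biUnion.2 ⟨c, by simpa using hc,
        mem_image.2 ⟨p, by simpa using hp, rfl⟩⟩⟩
    | high h ε x c hc p hp =>
      refine .inl (.inr ?_)
      exact mem_biUnion.2 ⟨(h, ε, x), mem_univ _, mem_biUnion.2 ⟨c, by simpa using hc,
        mem_image.2 ⟨p, by simpa using hp, rfl⟩⟩⟩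
    | pairs h α hα p q hp hq =>
      refine .inr ?_
      exact mem_biUnion.2 ⟨h, mem_univ _, mem_biUnion.2 ⟨α, by simp; omega,
        mem_image.2 ⟨(p, q), by simpa using ⟨hp, hq⟩, rfl⟩⟩⟩
  have h₁ : F₁.card ≤ 4 * B.ncard := by
    refine (card_biUnion_le_card_mul _ _ B.ncard fun u _ => ?_).trans (by simp)
    rw [Set.ncard_eq_toFinset_card']
    exact card_image_le
  have h₂ : F₂.card ≤ 16 * k ^ 2 := by
    refine card_image_le.trans ?_
    simp only [card_univ, Fintype.card_prod, ZMod.card]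
    exact le_of_eq (by ring)
  have huniv : (univ : Finset (ZMod 2 × ZMod 2 × ZMod (2 * k))).card = 8 * k := by
    simp only [card_univ, Fintype.card_prod, ZMod.card]
    ring
  have h₃ : F₃.card ≤ 8 * k * (k * (k - 1)) := by
    rw [← huniv]
    refine card_biUnion_le_card_mul _ _ _ fun u _ => ?_
    refine (card_biUnion_le_card_mul _ _ (k - 1) fun c hc => ?_).trans (by simp)
    refine card_image_le.trans ?_
    rw [← Set.ncard_eq_toFinset_card']
    exact hQ.ncard_low_le (mem_range.1 hc)
  have h₄ : F₄.card ≤ 8 * k * (k * k) := by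
    rw [← huniv]
    refine card_biUnion_le_card_mul _ _ _ fun u _ => ?_
    refine (card_biUnion_le_card_mul _ _ k fun c hc => ?_).trans (by simp)
    refine card_image_le.trans ?_
    rw [← Set.ncard_eq_toFinset_card']
    exact hQ.ncard_high_le (mem_range.1 hc)
  have h₅ : F₅.card ≤ 2 * ((2 * k - 1) * (k * k)) := by
    refine (card_biUnion_le_card_mul _ _ ((2 * k - 1) * (k * k)) fun h _ => ?_).trans
      (by simp)
    refine (card_biUnion_le_card_mul _ _ (k * k) fun α hα => ?_).trans (by simp)
    rw [mem_range] at hα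
    have := hP.ncard_le (α := α) (by omega)
    rw [Set.ncard_eq_toFinset_card'] at this
    refine card_image_le.trans ?_
    rw [card_product]
    exact Nat.mul_le_mul this this
  calc {b | NormalForm e B P Q b}.ncard
      ≤ (F₁ ∪ F₂ ∪ F₃ ∪ F₄ ∪ F₅).card := by
        rw [← Set.ncard_coe_finset]
        exact Set.ncard_le_ncard hsub (finite_toSet _)
    _ ≤ F₁.card + F₂.card + F₃.card + F₄.card + F₅.card := by
        refine (card_union_le _ _).trans (Nat.add_le_add_right ?_ _)
        refine (card_union_le _ _).trans (Nat.add_le_add_right ?_ _)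
        refine (card_union_le _ _).trans (Nat.add_le_add_right ?_ _)
        exact card_union_le _ _
    _ ≤ _ := by gcongr

theorem six_mul_choose_three (n : ℕ) : 6 * (n + 2).choose 3 = (n + 2) * (n + 1) * n := by
  have h := Nat.descFactorial_eq_factorial_mul_choose (n + 2) 3
  rw [show Nat.factorial 3 = 6 from rfl] at h
  rw [← h, Nat.descFactorial_succ, Nat.descFactorial_succ, Nat.descFactorial_one,
    show n + 2 - 2 = n by omega, show n + 2 - 1 = n + 1 by omega]
  ring

/-- Hanani's fifth construction yields a Steiner quadruple system. -/
theorem isSQS_blocks (hk : 0 < k) (hB : IsSQS (2 * k + 2) B) (hP : IsPairSystem k P)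
    (hQ : IsBarPairSystem k Q) : IsSQS (8 * k + 2) (blocks e B P Q) := by
  classical
  have : NeZero (2 * k) := ⟨by omega⟩
  have := hB.finite
  have := Fintype.ofFinite X
  have hcard : Fintype.card (Point k) = 8 * k + 2 := by
    simp only [Fintype.card_sum, Fintype.card_prod, ZMod.card]
    ring
  rw [← hcard]
  refine IsSQS.of_cover (fun b hb => hb.normalForm.card_eq hB hP hQ) ?_ ?_
  · intro T hT
    obtain ⟨p, q, r, hpq, hpr, hqr, rfl⟩ := card_eq_three.1 hT
    obtain ⟨b, hb, h1, h2, h3⟩ := covered_of_ne (e := e) hB hP hQ hpq hpr hqr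
    exact ⟨b, hb, by simp [insert_subset_iff, h1, h2, h3]⟩
  · rw [hcard]
    have h1 : (blocks e B P Q).ncard ≤ {b | NormalForm e B P Q b}.ncard :=
      Set.ncard_le_ncard (fun b hb => hb.normalForm) (Set.toFinite _)
    have h2 := ncard_normalForm_le (e := e) (B := B) hP hQ
    have h3 := hB.four_mul_ncard
    have h4 := six_mul_choose_three (2 * k)
    have h5 := six_mul_choose_three (8 * k)
    rw [← h3] at h4
    obtain ⟨m, rfl⟩ := Nat.exists_eq_add_of_le' hk
    rw [Nat.add_sub_cancel, show 2 * (m + 1) - 1 = 2 * m + 1 by omega] at h2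
    have h6 := h1.trans h2
    nlinarith

end Hanani

/-! ### Orders of systems with an overlap cycle -/

/-- A 1-overlap cycle consists of more than one string, since no string starts with its own last
letter; this excludes the orders up to `4`. -/
theorem IsSQS.four_lt_of_isOcycle {X : Type*} [DecidableEq X] {n : ℕ} {B : Set (Finset X)}
    (hB : IsSQS n B) {C : Cycle (List X)} (hC : IsOcycle 1 B C) : 4 < n := by
  classical
  have := hB.finite
  have := Fintype.ofFinite X
  have hcard := hB.card_points
  rw [Nat.card_eq_fintype_card] at hcard
  by_contra hn
  have huniv : ∀ w ∈ C, w.toFinset = Finset.univ := fun w hw => by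
    have h4 := hB.card_block _ ((hC.mem_blocks _).2 ⟨w, hw, rfl⟩)
    have := w.toFinset.card_le_univ
    exact (Finset.card_eq_iff_eq_univ _).1 (by omega)
  induction C using Cycle.induction_on with
  | nil => exact hC.ne_nil rfl
  | cons w L _ =>
    have hL : L = [] := by
      have hnd := hC.blocks_nodup
      rw [Cycle.map_coe, Cycle.nodup_coe_iff, List.map_cons, List.nodup_cons] at hnd
      refine List.eq_nil_iff_forall_not_mem.2 fun v hv => hnd.1 (List.mem_map.2 ⟨v, hv, ?_⟩)
      rw [huniv w (by simp), huniv v (by simp [hv])]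
    subst hL
    have hch := hC.overlap
    rw [Cycle.chain_singleton] at hch
    have hw := hC.letters_nodup w (by simp)
    have h4 := hB.card_block _ ((hC.mem_blocks _).2 ⟨w, by simp, rfl⟩)
    rw [List.toFinset_card_of_nodup hw] at h4
    match w, h4 with
    | [a, b, c, d], _ =>
      have : d = a := by simpa [List.rtake_eq_reverse_take_reverse] using hch
      simp [this] at hw

theorem mainTheorem6 {X : Type*} [DecidableEq X] (n : ℕ) (B : Set (Finset X))
    (hB : IsSQS n B) (hC : ∃ C : Cycle (List X), IsOcycle 1 B C) :
    ∃ k : ℕ, n = 2 * k + 2 ∧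
      Nonempty (X ≃ Hanani.Label k) ∧
      (∃ P, Hanani.IsPairSystem k P) ∧
      (∃ Q, Hanani.IsBarPairSystem k Q) ∧
      ∀ (e : X ≃ Hanani.Label k) (P Q : ℕ → Set (Sym2 (ZMod (2 * k)))),
        Hanani.IsPairSystem k P → Hanani.IsBarPairSystem k Q →
        IsSQS (4 * n - 6) (Hanani.blocks e B P Q) ∧
        ∃ C : Cycle (List (Hanani.Point k)),
          IsOcycle 1 (Hanani.blocks e B P Q) C ∧
          ∀ (h i : ZMod 2) (y : ZMod (2 * k)), IsOverlapPoint C (Hanani.pt h i y) := by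
  classical
  obtain ⟨C, hC⟩ := hC
  have hn := hB.four_lt_of_isOcycle hC
  have := hB.finite
  have := Fintype.ofFinite X
  have hcard := hB.card_points
  rw [Nat.card_eq_fintype_card] at hcard
  obtain ⟨x, y, hxy⟩ := Fintype.one_lt_card_iff.1 (by omega : 1 < Fintype.card X)
  obtain ⟨k, rfl⟩ : ∃ k, n = 2 * k + 2 :=
    ⟨_, (IsSQS.two_mul_card_pair (𝓑 := B.toFinset) (by simpa using hB) hxy).symm⟩
  have : NeZero (2 * k) := ⟨by omega⟩
  refine ⟨k, rfl, ⟨Fintype.equivOfCardEq ?_⟩, Hanani.exists_isPairSystem (by omega),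
    Hanani.exists_isBarPairSystem (by omega), fun e P Q hP hQ => ?_⟩
  · rw [hcard, Fintype.card_sum, ZMod.card, ZMod.card]
  · have hS := Hanani.isSQS_blocks (e := e) (by omega) hB hP hQ
    rw [show 4 * (2 * k + 2) - 6 = 8 * k + 2 by omega]
    obtain ⟨C', hC', hov⟩ := hS.exists_ocycle (by omega)
    exact ⟨hS, C', hC', fun h i y => hov _⟩
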